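/- **Proposition 2.9.** Let $\Gamma$ be a standard quantum graph: a connected metric graph with a finite set $\mathcal V$ of vertices and a finite non-empty set of $E$ edges (loops and multiple edges allowed), no vertex of degree two, and edge lengths $l_e>0$, equipped with the Laplacian $-\frac{d^2}{dx_e^2}$ on the functions that are in $H^2$ of every edge and satisfy the Neumann (Kirchhoff) conditions at every vertex, i.e. they are continuous there and their outgoing derivatives sum to zero. Write $|\Gamma|=\sum_e l_e$, $L_{\min}=\min_e l_e$, and $\partial\Gamma$ for the set of vertices of degree one. Let $\lambda_0\le\lambda_1\le\dots$ be the eigenvalues listed with multiplicity, $\{f_n\}_{n\ge 0}$ a real orthonormal basis of $L^2(\Gamma)$ of corresponding eigenfunctions, and $k_n=\sqrt{\lambda_n}$. Assume that $f_n$ is generic: $\lambda_n$ is simple, $f_n$ vanishes at no vertex, and no outgoing derivative of $f_n$ vanishes at a vertex of $\mathcal V\setminus\partial\Gamma$. Assume also $k_n>\pi/L_{\min}$. Let $\phi(f_n)$ be the number of zeros of $f_n$, and $\xi(f_n)$ the number of zeros of $f_n'$ (the Neumann points), in $\Gamma\setminus\mathcal V$; put $\sigma(n)=\phi(f_n)-n$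 and $\omega(n)=\xi(f_n)-n$. The Neumann domains of $f_n$ are the connected components of $\Gamma$ cut at the Neumann points, each considered as a metric graph with Neumann conditions at all its vertices, including the endpoints created by the cuts. A Neumann domain is non-trivial if it contains a vertex of $\mathcal V\setminus\partial\Gamma$. For $v\in\mathcal V\setminus\partial\Gamma$ let $\Omega_n^{(v)}$ be the Neumann domain containing $v$, let $N(\Omega_n^{(v)})$ be the number, counted with multiplicity, of eigenvalues $\lambda$ of $\Omega_n^{(v)}$ with $0\le\lambda<k_n^2$, and let $\rho(\Omega_n^{(v)})=|\Omega_n^{(v)}|\,k_n/\pi$, where $|\Omega_n^{(v)}|$ is its total length. Then the domains $\Omega_n^{(v)}$, $v\in\mathcal V\setminus\partial\Gamma$, are pairwise distinct (so that the sums below run over all non-trivial Neumann domains, each taken once), and $$\sum_{v\in\mathcal V\setminus\partial\Gamma}N(\Omega_n^{(v)})=\sigma(n)-\omega(n)+(E-|\partial\Gamma|),$$ $$\sum_{v\in\mathcal V\setminus\partial\Gamma}\rho(\Omega_n^{(v)})=\frac{|\Gamma|k_n}{\pi}-(\omega(n)+n)+(E-|\partial\Gamma|),$$ $$\sum_{v\in\mathcal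 V\setminus\partial\Gamma}\bigl(N(\Omega_n^{(v)})-\rho(\Omega_n^{(v)})\bigr)=\Bigl(n-\frac{|\Gamma|k_n}{\pi}\Bigr)+\sigma(n).$$ -/

import Mathlib

open MeasureTheory Set

noncomputable section

/-- A metric graph with vertex set `V` and edge set `E`.  Loops and multiple edges are allowed.
Every edge `e` is identified with the interval `[0, len e]`; the coordinate `0` sits at the vertex
`src e` and the coordinate `len e` at the vertex `tgt e`. -/
structure MetricGraph (V E : Type*) where
  src : E → V
  tgt : E → V
  len : E → ℝ
  len_pos : ∀ e, 0 < len e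

namespace MetricGraph

variable {V E : Type*} (G : MetricGraph V E)

/-! ### Combinatorics -/

/-- The vertex at which an edge end sits.  The ends of `e` are `(e, false)` (coordinate `0`)
and `(e, true)` (coordinate `len e`). -/
def vert (h : E × Bool) : V := if h.2 then G.tgt h.1 else G.src h.1

/-- The edge ends at `v`; a loop at `v` contributes two of them. -/
def ends (v : V) : Set (E × Bool) := {h | G.vert h = v}

def degree (v : V) : ℕ := (G.ends v).ncard

/-- The boundary: all vertices of degree one. -/
def boundary : Set V := {v | G.degree v = 1}

open Classical in
/-- The interior vertices: all vertices that are not in the boundary. -/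
def interiorVertices [Fintype V] : Finset V := Finset.univ.filter (fun v => v ∉ G.boundary)

/-- The simple graph in which two distinct vertices are adjacent if some edge joins them. -/
def toSimple : SimpleGraph V := SimpleGraph.fromRel (fun u w => ∃ e, G.src e = u ∧ G.tgt e = w)

/-- Sum of all edge lengths. -/
def totalLength : ℝ := ∑ᶠ e, G.len e

/-- Minimal edge length. -/
def minLength : ℝ := ⨅ e, G.len e

/-- Standard graphs: finite, connected, with at least one edge and no vertex of degree two
(finiteness of both sets is carried by the instances). -/
structure IsStandard [Fintype V] [Fintype E] : Prop where
  connected : G.toSimple.Connected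
  nonempty_edges : Nonempty E
  degree_ne_two : ∀ v, G.degree v ≠ 2

/-! ### The Laplacian with Neumann (Kirchhoff) vertex conditions

A real function on the graph is a family `f : E → ℝ → ℝ`; only the values of `f e` on `[0, len e]`
matter. -/

/-- The edge `e` as the interval `[0, len e]`. -/
def seg (e : E) : Set ℝ := Icc 0 (G.len e)

/-- Lebesgue measure on the edge `e`. -/
def edgeMeasure (e : E) : Measure ℝ := volume.restrict (G.seg e)

/-- The derivative of `f` along the edge `e` (one-sided at the two ends). -/
def edgeDeriv (f : E → ℝ → ℝ) (e : E) (x : ℝ) : ℝ := derivWithin (f e) (G.seg e) x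

/-- The value of `f` at an edge end. -/
def endValue (f : E → ℝ → ℝ) (h : E × Bool) : ℝ := f h.1 (if h.2 then G.len h.1 else 0)

/-- The outgoing derivative of `f` at an edge end, pointing from the vertex into the edge. -/
def outDeriv (f : E → ℝ → ℝ) (h : E × Bool) : ℝ :=
  if h.2 then - G.edgeDeriv f h.1 (G.len h.1) else G.edgeDeriv f h.1 0

/-- `f` is in the domain of the Laplacian and `Δ f = u`.  On each edge `f` is in `H²`, that is,
`f` is differentiable, `f'` is absolutely continuous and `-f'' = u` almost everywhere with `u` in
`L²`; at each vertex `f` is continuous and the outgoing derivatives add up to zero.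
(For a vertex of finite degree `HasSum` is just the finite sum.) -/
structure HasLaplacian (f u : E → ℝ → ℝ) : Prop where
  differentiableOn : ∀ e, DifferentiableOn ℝ (f e) (G.seg e)
  memLp : ∀ e, MemLp (u e) 2 (G.edgeMeasure e)
  deriv_eq : ∀ e, ∀ x ∈ G.seg e,
    G.edgeDeriv f e x = G.edgeDeriv f e 0 - ∫ t in (0 : ℝ)..x, u e t
  continuous_at : ∀ h h', G.vert h = G.vert h' → G.endValue f h = G.endValue f h'
  kirchhoff : ∀ v, HasSum (fun h : G.ends v => G.outDeriv f h) 0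

variable {G} in
theorem HasLaplacian.add {f₁ f₂ u₁ u₂ : E → ℝ → ℝ} (h₁ : G.HasLaplacian f₁ u₁)
    (h₂ : G.HasLaplacian f₂ u₂) : G.HasLaplacian (f₁ + f₂) (u₁ + u₂) := by
  have key : ∀ e, ∀ x ∈ G.seg e,
      G.edgeDeriv (f₁ + f₂) e x = G.edgeDeriv f₁ e x + G.edgeDeriv f₂ e x := fun e x hx =>
    derivWithin_add (h₁.differentiableOn e x hx) (h₂.differentiableOn e x hx)
  have h0 : ∀ e, (0 : ℝ) ∈ G.seg e := fun e => ⟨le_rfl, (G.len_pos e).le⟩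
  have hl : ∀ e, G.len e ∈ G.seg e := fun e => ⟨(G.len_pos e).le, le_rfl⟩
  have hint : ∀ (u : E → ℝ → ℝ) e, MemLp (u e) 2 (G.edgeMeasure e) → ∀ x ∈ G.seg e,
      IntervalIntegrable (u e) volume 0 x := by
    intro u e hu x hx
    have : IsFiniteMeasure (G.edgeMeasure e) := by
      unfold edgeMeasure seg; infer_instance
    have := hu.integrable (by norm_num)
    rw [intervalIntegrable_iff_integrableOn_Icc_of_le hx.1]
    exact IntegrableOn.mono_set this (Icc_subset_Icc le_rfl hx.2)
  refine ⟨fun e => (h₁.differentiableOn e).add (h₂.differentiableOn e),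
    fun e => (h₁.memLp e).add (h₂.memLp e), ?_, ?_, ?_⟩
  · intro e x hx
    rw [key e x hx, key e 0 (h0 e), h₁.deriv_eq e x hx, h₂.deriv_eq e x hx]
    have : ∫ t in (0 : ℝ)..x, (u₁ + u₂) e t
        = (∫ t in (0 : ℝ)..x, u₁ e t) + ∫ t in (0 : ℝ)..x, u₂ e t :=
      intervalIntegral.integral_add (hint u₁ e (h₁.memLp e) x hx) (hint u₂ e (h₂.memLp e) x hx)
    rw [this]; ring
  · intro h h' hh
    exact congrArg₂ (· + ·) (h₁.continuous_at h h' hh) (h₂.continuous_at h h' hh)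
  · intro v
    have := (h₁.kirchhoff v).add (h₂.kirchhoff v)
    rw [add_zero] at this
    have hh : ∀ h, G.outDeriv (f₁ + f₂) h = G.outDeriv f₁ h + G.outDeriv f₂ h := by
      intro h
      unfold outDeriv
      split
      · rw [key _ _ (hl _)]; ring
      · rw [key _ _ (h0 _)]
    simpa only [hh] using this

variable {G} in
theorem HasLaplacian.smul (c : ℝ) {f u : E → ℝ → ℝ} (hf : G.HasLaplacian f u) :
    G.HasLaplacian (c • f) (c • u) := by
  have key : ∀ e, ∀ x ∈ G.seg e, G.edgeDeriv (c • f) e x = c * G.edgeDeriv f e x :=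
    fun e x hx => derivWithin_const_smul c (hf.differentiableOn e x hx)
  have h0 : ∀ e, (0 : ℝ) ∈ G.seg e := fun e => ⟨le_rfl, (G.len_pos e).le⟩
  have hl : ∀ e, G.len e ∈ G.seg e := fun e => ⟨(G.len_pos e).le, le_rfl⟩
  refine ⟨fun e => (hf.differentiableOn e).const_smul c,
    fun e => (hf.memLp e).const_smul c, ?_, ?_, ?_⟩
  · intro e x hx
    rw [key e x hx, key e 0 (h0 e), hf.deriv_eq e x hx]
    have : ∫ t in (0 : ℝ)..x, (c • u) e t = c * ∫ t in (0 : ℝ)..x, u e t :=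
      intervalIntegral.integral_const_mul c _
    rw [this]; ring
  · intro h h' hh
    exact congrArg (c * ·) (hf.continuous_at h h' hh)
  · intro v
    have := (hf.kirchhoff v).mul_left c
    rw [mul_zero] at this
    have hh : ∀ h, G.outDeriv (c • f) h = c * G.outDeriv f h := by
      intro h
      unfold outDeriv
      split
      · rw [key _ _ (hl _)]; ring
      · rw [key _ _ (h0 _)]
    simpa only [hh] using this

/-- The solution space of `Δ f = lam f`.  The irrelevant values of `f e` off `[0, len e]` are
normalized to zero, so that the elements are exactly the functions on the graph. -/
def eigenspace (lam : ℝ) : Submodule ℝ (E → ℝ → ℝ) where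
  carrier := {f | (∀ e, ∀ x ∉ G.seg e, f e x = 0) ∧ G.HasLaplacian f (lam • f)}
  add_mem' := by
    rintro a b ⟨ha, ha'⟩ ⟨hb, hb'⟩
    refine ⟨fun e x hx => ?_, ?_⟩
    · simp [ha e x hx, hb e x hx]
    · rw [smul_add]; exact ha'.add hb'
  zero_mem' := by
    refine ⟨fun _ _ _ => rfl, ?_⟩
    rw [smul_zero]
    have hd : ∀ e x, G.edgeDeriv 0 e x = 0 := fun e x => by simp [edgeDeriv]
    have ho : ∀ h, G.outDeriv 0 h = 0 := fun h => by simp [outDeriv, hd]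
    refine ⟨fun e => differentiableOn_const 0, fun e => MemLp.zero, ?_, fun _ _ _ => rfl, ?_⟩
    · intro e x _; simp [hd]
    · intro v; simp only [ho]; exact hasSum_zero
  smul_mem' := by
    rintro c f ⟨hf, hf'⟩
    refine ⟨fun e x hx => ?_, ?_⟩
    · simp [hf e x hx]
    · rw [smul_comm]; exact hf'.smul c

/-- The number of eigenvalues `μ` of the graph with `0 ≤ μ < lam`, counted with multiplicity. -/
def spectralPosition (lam : ℝ) : ℕ := ∑ᶠ μ ∈ Ico 0 lam, Module.finrank ℝ (G.eigenspace μ)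

/-- `f 0, f 1, …` is a real orthonormal basis of `L²` of the graph, where `f n` is an eigenfunction
for the eigenvalue `lam n` and `lam 0 ≤ lam 1 ≤ …` (so the eigenvalues are listed in increasing
order, with multiplicity). -/
structure IsEigenbasis [Fintype E] (f : ℕ → E → ℝ → ℝ) (lam : ℕ → ℝ) : Prop where
  monotone : Monotone lam
  mem_eigenspace : ∀ n, f n ∈ G.eigenspace (lam n)
  orthonormal : ∀ m n,
    ∑ e, ∫ x, f m e x * f n e x ∂(G.edgeMeasure e) = if m = n then 1 else 0
  complete : ∀ u : E → ℝ → ℝ, (∀ e, MemLp (u e) 2 (G.edgeMeasure e)) →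
    (∀ n, ∑ e, ∫ x, u e x * f n e x ∂(G.edgeMeasure e) = 0) →
    ∀ e, u e =ᵐ[G.edgeMeasure e] 0

/-- Generic eigenfunctions for the eigenvalue `lam`. -/
structure IsGeneric (f : E → ℝ → ℝ) (lam : ℝ) : Prop where
  mem_eigenspace : f ∈ G.eigenspace lam
  ne_zero : f ≠ 0
  simple : Module.finrank ℝ (G.eigenspace lam) = 1
  value_ne_zero : ∀ v, ∀ h ∈ G.ends v, G.endValue f h ≠ 0
  outDeriv_ne_zero : ∀ v ∉ G.boundary, ∀ h ∈ G.ends v, G.outDeriv f h ≠ 0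

/-! ### Nodal points, Neumann points and Neumann domains -/

/-- Zeros of `f` in the open edges; the point with coordinate `x` on `e` is the pair `(e, x)`. -/
def nodalPoints (f : E → ℝ → ℝ) : Set (E × ℝ) := {p | p.2 ∈ Ioo 0 (G.len p.1) ∧ f p.1 p.2 = 0}

/-- Zeros of the derivative of `f` in the open edges. -/
def neumannPoints (f : E → ℝ → ℝ) : Set (E × ℝ) :=
  {p | p.2 ∈ Ioo 0 (G.len p.1) ∧ G.edgeDeriv f p.1 p.2 = 0}

def nodalCount (f : E → ℝ → ℝ) : ℕ := (G.nodalPoints f).ncard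

def neumannCount (f : E → ℝ → ℝ) : ℕ := (G.neumannPoints f).ncard

/-- The nodal surplus of the eigenfunction `f` with index `n`. -/
def nodalSurplus (f : E → ℝ → ℝ) (n : ℕ) : ℤ := G.nodalCount f - n

/-- The Neumann surplus of the eigenfunction `f` with index `n`. -/
def neumannSurplus (f : E → ℝ → ℝ) (n : ℕ) : ℤ := G.neumannCount f - n

/-- The two ends of the edge `e` and the points of `S` on it, as coordinates. -/
def cutCoords (S : Set (E × ℝ)) (e : E) : Set ℝ := {0, G.len e} ∪ {x | (e, x) ∈ S}

/-- The pieces into which a set `S` of points inside the edges cuts the edges: `(e, a, b)` is the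
segment `[a, b]` of `e`, where `a < b` are consecutive cut coordinates. -/
def CutEdge (S : Set (E × ℝ)) : Type _ :=
  {p : E × ℝ × ℝ // p.2.1 ∈ G.cutCoords S p.1 ∧ p.2.2 ∈ G.cutCoords S p.1 ∧ p.2.1 < p.2.2 ∧
    ∀ y ∈ G.cutCoords S p.1, ¬ (p.2.1 < y ∧ y < p.2.2)}

open Classical in
/-- The metric graph that results from cutting `G` at the points of `S` (which lie in the open
edges).  Its vertices are those of `G` and two copies of each `p` in `S`, each an end of one piece
only: `(p, false)` ends the piece to the left of `p`, and `(p, true)` the piece to its right. -/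
def cut (S : Set (E × ℝ)) : MetricGraph (V ⊕ (S × Bool)) (G.CutEdge S) where
  src p := if h : (p.1.1, p.1.2.1) ∈ S then Sum.inr (⟨_, h⟩, true) else Sum.inl (G.src p.1.1)
  tgt p := if h : (p.1.1, p.1.2.2) ∈ S then Sum.inr (⟨_, h⟩, false) else Sum.inl (G.tgt p.1.1)
  len p := p.1.2.2 - p.1.2.1
  len_pos p := sub_pos.2 p.2.2.2.1

theorem reachable_tgt {v : V} {e : E} (h : G.toSimple.Reachable v (G.src e)) :
    G.toSimple.Reachable v (G.tgt e) := by
  by_cases he : G.src e = G.tgt e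
  · rwa [← he]
  · exact h.trans (SimpleGraph.Adj.reachable ⟨he, Or.inl ⟨e, rfl, rfl⟩⟩)

/-- The connected component of the vertex `v`, as a metric graph. -/
def component (v : V) :
    MetricGraph {w : V // G.toSimple.Reachable v w}
      {e : E // G.toSimple.Reachable v (G.src e)} where
  src e := ⟨G.src e.1, e.2⟩
  tgt e := ⟨G.tgt e.1, G.reachable_tgt e.2⟩
  len e := G.len e.1
  len_pos e := G.len_pos e.1

/-- `u` and `v` lie in the same Neumann domain of `f`. -/
def SameNeumannDomain (f : E → ℝ → ℝ) (u v : V) : Prop :=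
  (G.cut (G.neumannPoints f)).toSimple.Reachable (Sum.inl u) (Sum.inl v)

/-- The Neumann domain of `f` that contains the vertex `v`, as a metric graph: the component of `v`
in the graph cut at the Neumann points of `f`. -/
abbrev neumannDomain (f : E → ℝ → ℝ) (v : V) :=
  (G.cut (G.neumannPoints f)).component (Sum.inl v)

/-- Spectral position `N` of the Neumann domain containing `v`, where `k ^ 2` is the eigenvalue
of `f`. -/
def domainPosition (f : E → ℝ → ℝ) (k : ℝ) (v : V) : ℕ :=
  (G.neumannDomain f v).spectralPosition (k ^ 2)

/-- Wavelength capacity `ρ` of the Neumann domain containing `v`, where `k ^ 2` is the eigenvalue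
of `f`. -/
def domainCapacity (f : E → ℝ → ℝ) (k : ℝ) (v : V) : ℝ :=
  (G.neumannDomain f v).totalLength * k / Real.pi

end MetricGraph

end

/-! On each edge f is a cosine R cos(k(x - a)), and k l_e > π forces a Neumann point onto every
edge. If an edge has m + 1 of them, f runs through m half periods between the first and the last,
each with one zero, and the two remaining end pieces have lengths in (0, π/k]. An end piece contains
a zero exactly when k times its length exceeds π/2. With ℓ_h the length of the piece at the edge end
h, summation over the edges gives φ - ξ + E = Σ_h [kℓ_h > π/2] and |Γ|k/π - ξ + E = Σ_h kℓ_h/π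
(`IsWave.nodalCount_add_card`, `IsWave.totalLength_add_card`). At a vertex of degree one f'
vanishes, so kℓ_h = π and the end adds 1 to both sums; this is the source of |∂Γ|.

Since every edge is cut, the domain of v is the star of the end pieces at v
(`isStar_component_cut`). The capacity formula follows at once, and the position formula reduces to
a claim about stars: N is the number of edges with kℓ_i > π/2 (`finsum_finrank_starCoeff`). On a
star the eigenfunctions for κ² are a_i cos(κ · distance to the leaf). Away from the poles κ =
π/(2ℓ_i) the eigenvalues are the zeros of Σ tan(κℓ_i), each simple; a pole shared by d edges has
multiplicity d - 1. As kℓ_i < π, each edge has at most one pole below k. The tangent sum increases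
strictly between poles, so there is one zero before each distinct pole (κ = 0 before the first), and
none between the last pole and k, because f itself makes k a zero. A pole shared by d edges thus
accounts for 1 + (d - 1) eigenvalues, which counts every edge with a pole below k once.

The third identity is the difference of the other two. -/

/-! ### The harmonic oscillator on an interval. -/

theorem eqOn_const_of_hasDerivWithinAt_zero {l : ℝ} {F : ℝ → ℝ}
    (hF : ∀ x ∈ Icc 0 l, HasDerivWithinAt F 0 (Icc 0 l) x) {x y : ℝ} (hx : x ∈ Icc 0 l)
    (hy : y ∈ Icc 0 l) : F x = F y := by
  have h := (convex_Icc (0 : ℝ) l).norm_image_sub_le_of_norm_hasDerivWithin_le (C := 0)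
    hF (fun x _ => by simp) hy hx
  rw [zero_mul, norm_le_zero_iff, sub_eq_zero] at h
  exact h

/-- Conserved quantities of the harmonic oscillator on `[0, l]`. -/
theorem harmonic_solution {l κ : ℝ} {f g : ℝ → ℝ}
    (hf : ∀ x ∈ Icc 0 l, HasDerivWithinAt f (g x) (Icc 0 l) x)
    (hg : ∀ x ∈ Icc 0 l, HasDerivWithinAt g (-(κ ^ 2 * f x)) (Icc 0 l) x)
    {x₀ x : ℝ} (hx₀ : x₀ ∈ Icc 0 l) (hx : x ∈ Icc 0 l) :
    κ * f x = κ * f x₀ * Real.cos (κ * (x - x₀)) + g x₀ * Real.sin (κ * (x - x₀)) ∧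
    g x = g x₀ * Real.cos (κ * (x - x₀)) - κ * f x₀ * Real.sin (κ * (x - x₀)) := by
  have hlin : ∀ y, HasDerivWithinAt (fun y => κ * (y - x₀)) κ (Icc 0 l) y := fun y => by
    simpa using (((hasDerivAt_id y).sub_const x₀).const_mul κ).hasDerivWithinAt
  -- The phase point (κf, g) rotated back by the angle κ(y - x₀) stands still; `hP` and `hQ` are its
  -- two coordinates.
  have hP := @eqOn_const_of_hasDerivWithinAt_zero l
    (fun y => κ * f y * Real.cos (κ * (y - x₀)) - g y * Real.sin (κ * (y - x₀)))
    (fun y hy => by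
      refine ((((hf y hy).const_mul κ).mul (hlin y).cos).sub
        ((hg y hy).mul (hlin y).sin)).congr_deriv ?_
      ring) x x₀ hx hx₀
  have hQ := @eqOn_const_of_hasDerivWithinAt_zero l
    (fun y => κ * f y * Real.sin (κ * (y - x₀)) + g y * Real.cos (κ * (y - x₀)))
    (fun y hy => by
      refine ((((hf y hy).const_mul κ).mul (hlin y).sin).add
        ((hg y hy).mul (hlin y).cos)).congr_deriv ?_
      ring) x x₀ hx hx₀
  simp only [sub_self, mul_zero, Real.cos_zero, Real.sin_zero, mul_one, sub_zero, zero_add] at hP hQ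
  have h1 := Real.sin_sq_add_cos_sq (κ * (x - x₀))
  constructor
  · linear_combination (-κ * f x) * h1 + Real.cos (κ * (x - x₀)) * hP +
      Real.sin (κ * (x - x₀)) * hQ
  · linear_combination (-g x) * h1 + Real.cos (κ * (x - x₀)) * hQ -
      Real.sin (κ * (x - x₀)) * hP

/-- The factor κ in `harmonic_solution` cancels unless κ = 0; in that case g vanishes identically
and f is constant. -/
theorem harmonic_solution_of_critical {l κ : ℝ} {f g : ℝ → ℝ}
    (hf : ∀ x ∈ Icc 0 l, HasDerivWithinAt f (g x) (Icc 0 l) x)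
    (hg : ∀ x ∈ Icc 0 l, HasDerivWithinAt g (-(κ ^ 2 * f x)) (Icc 0 l) x)
    {x₀ x : ℝ} (hx₀ : x₀ ∈ Icc 0 l) (hx : x ∈ Icc 0 l) (h0 : g x₀ = 0) :
    f x = f x₀ * Real.cos (κ * (x - x₀)) := by
  rcases eq_or_ne κ 0 with rfl | hκ
  · have : ∀ y ∈ Icc 0 l, g y = 0 := fun y hy => by
      simpa [h0] using (harmonic_solution hf hg hx₀ hy).2
    simpa using eqOn_const_of_hasDerivWithinAt_zero
      (fun y hy => by simpa [this y hy] using hf y hy) hx hx₀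
  · have := (harmonic_solution hf hg hx₀ hx).1
    rw [h0] at this
    exact mul_left_cancel₀ hκ (by linear_combination this)

/-! ### The eigenvalue equation on the edges of a graph. -/

namespace MetricGraph

variable {V E : Type*} {G : MetricGraph V E}

theorem zero_mem_seg (e : E) : (0 : ℝ) ∈ G.seg e := ⟨le_rfl, (G.len_pos e).le⟩

theorem len_mem_seg (e : E) : G.len e ∈ G.seg e := ⟨(G.len_pos e).le, le_rfl⟩

theorem hasDerivWithinAt_edgeDeriv {f : E → ℝ → ℝ} {e : E}
    (hf : DifferentiableOn ℝ (f e) (G.seg e)) {x : ℝ} (hx : x ∈ G.seg e) :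
    HasDerivWithinAt (f e) (G.edgeDeriv f e x) (G.seg e) x :=
  (hf x hx).hasDerivWithinAt

theorem edgeDeriv_eq {f : E → ℝ → ℝ} {e : E} {x d : ℝ} (hx : x ∈ G.seg e)
    (h : HasDerivWithinAt (f e) d (G.seg e) x) : G.edgeDeriv f e x = d :=
  h.derivWithin (uniqueDiffOn_Icc (G.len_pos e) x hx)

/-- Regularity: the right-hand side c f is continuous, so the integral form of the equation can be
differentiated everywhere. -/
theorem HasLaplacian.hasDerivWithinAt_deriv {f : E → ℝ → ℝ} {c : ℝ}
    (h : G.HasLaplacian f (c • f)) {e : E} {x : ℝ} (hx : x ∈ G.seg e) :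
    HasDerivWithinAt (G.edgeDeriv f e) (-(c * f e x)) (G.seg e) x := by
  -- The constant extension beyond the ends is continuous on ℝ, so the two-sided fundamental theorem
  -- of calculus applies at the ends too.
  set F : ℝ → ℝ := IccExtend (G.len_pos e).le ((Icc 0 (G.len e)).domRestrict (f e)) with hFdef
  have hFc : Continuous F :=
    ((h.differentiableOn e).continuousOn.domRestrict).Icc_extend'
  have hFe : ∀ y ∈ G.seg e, F y = f e y := fun y hy => by
    exact IccExtend_of_mem (G.len_pos e).le _ hy
  have hd : HasDerivAt (fun y => G.edgeDeriv f e 0 - ∫ t in (0 : ℝ)..y, c * F t)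
      (-(c * F x)) x := by
    have := (intervalIntegral.integral_hasDerivAt_right
      ((hFc.const_smul c).intervalIntegrable 0 x)
      ((hFc.const_smul c).stronglyMeasurableAtFilter _ _)
      (hFc.const_smul c).continuousAt).const_sub (G.edgeDeriv f e 0)
    simpa using this
  rw [hFe x hx] at hd
  refine hd.hasDerivWithinAt.congr (fun y hy => ?_) ?_
  all_goals
    rw [h.deriv_eq e _ ‹_›]
    congr 1
    refine intervalIntegral.integral_congr fun t ht => ?_
    rw [uIcc_of_le (by first | exact hy.1 | exact hx.1)] at ht
    simp only [Pi.smul_apply, smul_eq_mul]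
    rw [hFe t ⟨ht.1, ht.2.trans (by first | exact hy.2 | exact hx.2)⟩]

/-- Edgewise form of the eigenvalue equation `Δ f = κ² f`. -/
theorem HasLaplacian.solution {f : E → ℝ → ℝ} {κ : ℝ}
    (h : G.HasLaplacian f (κ ^ 2 • f)) {e : E} {x₀ x : ℝ} (hx₀ : x₀ ∈ G.seg e)
    (hx : x ∈ G.seg e) :
    κ * f e x = κ * f e x₀ * Real.cos (κ * (x - x₀)) +
        G.edgeDeriv f e x₀ * Real.sin (κ * (x - x₀)) ∧
    G.edgeDeriv f e x = G.edgeDeriv f e x₀ * Real.cos (κ * (x - x₀)) -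
        κ * f e x₀ * Real.sin (κ * (x - x₀)) :=
  harmonic_solution (l := G.len e)
    (fun _ hy => hasDerivWithinAt_edgeDeriv (h.differentiableOn e) hy)
    (fun _ hy => h.hasDerivWithinAt_deriv hy) hx₀ hx

theorem HasLaplacian.solution_of_critical {f : E → ℝ → ℝ} {κ : ℝ}
    (h : G.HasLaplacian f (κ ^ 2 • f)) {e : E} {x₀ x : ℝ} (hx₀ : x₀ ∈ G.seg e)
    (hx : x ∈ G.seg e) (h0 : G.edgeDeriv f e x₀ = 0) :
    f e x = f e x₀ * Real.cos (κ * (x - x₀)) :=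
  harmonic_solution_of_critical (l := G.len e)
    (fun _ hy => hasDerivWithinAt_edgeDeriv (h.differentiableOn e) hy)
    (fun _ hy => h.hasDerivWithinAt_deriv hy) hx₀ hx h0

/-- The converse: a function of the form `a e * cos (κ * (x - y e))` on every edge satisfies the
eigenvalue equation on the edges. -/
theorem hasDerivWithinAt_of_eqOn_cos {f : E → ℝ → ℝ} {κ a y : ℝ} {e : E}
    (hf : ∀ x ∈ G.seg e, f e x = a * Real.cos (κ * (x - y))) {x : ℝ} (hx : x ∈ G.seg e) :
    HasDerivWithinAt (f e) (-(κ * a * Real.sin (κ * (x - y)))) (G.seg e) x := by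
  have h : HasDerivAt (fun x => a * Real.cos (κ * (x - y)))
      (-(κ * a * Real.sin (κ * (x - y)))) x := by
    refine (((((hasDerivAt_id x).sub_const y).const_mul κ).cos).const_mul a).congr_deriv ?_
    simp; ring
  exact h.hasDerivWithinAt.congr hf (hf x hx)

theorem edgeDeriv_of_eqOn_cos {f : E → ℝ → ℝ} {κ a y : ℝ} {e : E}
    (hf : ∀ x ∈ G.seg e, f e x = a * Real.cos (κ * (x - y))) {x : ℝ} (hx : x ∈ G.seg e) :
    G.edgeDeriv f e x = -(κ * a * Real.sin (κ * (x - y))) :=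
  edgeDeriv_eq hx (hasDerivWithinAt_of_eqOn_cos hf hx)

theorem hasLaplacian_of_eqOn_cos {f : E → ℝ → ℝ} {κ : ℝ} {a y : E → ℝ}
    (hf : ∀ e, ∀ x ∈ G.seg e, f e x = a e * Real.cos (κ * (x - y e)))
    (hc : ∀ h h', G.vert h = G.vert h' → G.endValue f h = G.endValue f h')
    (hk : ∀ v, HasSum (fun h : G.ends v => G.outDeriv f h) 0) :
    G.HasLaplacian f (κ ^ 2 • f) := by
  have hd : ∀ e, DifferentiableOn ℝ (f e) (G.seg e) := fun e x hx =>
    (hasDerivWithinAt_of_eqOn_cos (hf e) hx).differentiableWithinAt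
  refine ⟨hd, fun e => ?_, fun e x hx => ?_, hc, hk⟩
  · have : IsFiniteMeasure (G.edgeMeasure e) := by unfold edgeMeasure seg; infer_instance
    refine MemLp.of_bound (C := κ ^ 2 * |a e|)
      (((hd e).continuousOn.const_smul (κ ^ 2)).aestronglyMeasurable measurableSet_Icc) ?_
    refine ae_restrict_of_forall_mem measurableSet_Icc fun x hx => ?_
    rw [Pi.smul_apply, Pi.smul_apply, hf e x hx, smul_eq_mul, Real.norm_eq_abs, abs_mul, abs_mul,
      abs_of_nonneg (sq_nonneg κ)]
    exact mul_le_mul_of_nonneg_left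
      (mul_le_of_le_one_right (abs_nonneg _) (Real.abs_cos_le_one _)) (sq_nonneg κ)
  · rw [edgeDeriv_of_eqOn_cos (hf e) hx, edgeDeriv_of_eqOn_cos (hf e) (zero_mem_seg e)]
    have h1 : ∫ t in (0 : ℝ)..x, (κ ^ 2 • f) e t =
        ∫ t in (0 : ℝ)..x, κ ^ 2 * (a e * Real.cos (κ * (t - y e))) := by
      refine intervalIntegral.integral_congr fun t ht => ?_
      rw [uIcc_of_le hx.1] at ht
      simp only [Pi.smul_apply, smul_eq_mul]
      rw [hf e t ⟨ht.1, ht.2.trans hx.2⟩]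
    have h2 : ∀ t, HasDerivAt (fun t => κ * a e * Real.sin (κ * (t - y e)))
        (κ ^ 2 * (a e * Real.cos (κ * (t - y e)))) t := fun t => by
      refine (((((hasDerivAt_id t).sub_const (y e)).const_mul κ).sin).const_mul
        (κ * a e)).congr_deriv ?_
      simp; ring
    rw [h1, intervalIntegral.integral_eq_sub_of_hasDerivAt (fun t _ => h2 t)
      (Continuous.intervalIntegrable (by fun_prop) _ _)]
    ring

end MetricGraph

/-! ### Eigenspaces of star graphs. -/

namespace MetricGraph

variable {W F : Type*} {H : MetricGraph W F} {c : W} {o : F → Bool}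

/-- `H` is a star with center `c`: the end `(i, o i)` of every edge `i` is at `c` and its other end
is at a vertex of degree one. -/
structure IsStar (H : MetricGraph W F) (c : W) (o : F → Bool) : Prop where
  center : ∀ i, H.vert (i, o i) = c
  leaf : ∀ i h, H.vert h = H.vert (i, !o i) → h = (i, !o i)

/-- The coordinate of an edge end. -/
noncomputable def pos (H : MetricGraph W F) (h : F × Bool) : ℝ := if h.2 then H.len h.1 else 0

theorem pos_mem_seg (h : F × Bool) : H.pos h ∈ H.seg h.1 := by
  unfold pos
  split
  · exact len_mem_seg _
  · exact zero_mem_seg _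

theorem endValue_eq (f : F → ℝ → ℝ) (h : F × Bool) : H.endValue f h = f h.1 (H.pos h) := rfl

theorem outDeriv_eq_zero_iff (f : F → ℝ → ℝ) (h : F × Bool) :
    H.outDeriv f h = 0 ↔ H.edgeDeriv f h.1 (H.pos h) = 0 := by
  unfold outDeriv pos
  split <;> simp

theorem IsStar.center_ne_leaf (hH : H.IsStar c o) (i : F) : H.vert (i, !o i) ≠ c := by
  intro h
  have := hH.leaf i (i, o i) (by rw [h, hH.center])
  simp at this

theorem IsStar.mem_ends (hH : H.IsStar c o) (h : F × Bool) : h ∈ H.ends c ↔ h.2 = o h.1 := by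
  obtain ⟨i, b⟩ := h
  constructor
  · intro h
    by_contra hne
    have : b = !o i := by revert hne; cases b <;> cases o i <;> simp
    exact hH.center_ne_leaf i (this ▸ h)
  · intro h
    have h : b = o i := h
    exact h ▸ hH.center i

theorem IsStar.hasSum_ends (hH : H.IsStar c o) [Fintype F] {g : F × Bool → ℝ} {s : ℝ} :
    HasSum (fun h : H.ends c => g h) s ↔ ∑ i, g (i, o i) = s := by
  let φ : F ≃ H.ends c :=
    { toFun := fun i => ⟨(i, o i), hH.center i⟩
      invFun := fun h => h.1.1
      left_inv := fun i => rfl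
      right_inv := fun h => Subtype.ext (Prod.ext rfl ((hH.mem_ends h.1).1 h.2).symm) }
  rw [← φ.hasSum_iff]
  exact ⟨fun h => (hasSum_fintype _).unique h, fun h => h ▸ hasSum_fintype _⟩

/-- The Kirchhoff sum at a leaf has a single term. -/
theorem IsStar.edgeDeriv_leaf (hH : H.IsStar c o) {f u : F → ℝ → ℝ} (hf : H.HasLaplacian f u)
    (i : F) : H.edgeDeriv f i (H.pos (i, !o i)) = 0 := by
  refine (outDeriv_eq_zero_iff (H := H) f (i, !o i)).1 ?_
  have h1 := hf.kirchhoff (H.vert (i, !o i))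
  have h2 := hasSum_single (f := fun h : H.ends (H.vert (i, !o i)) => H.outDeriv f h)
    ⟨(i, !o i), rfl⟩ (fun h hne => (hne (Subtype.ext (hH.leaf i h.1 h.2))).elim)
  exact h2.unique h1

theorem cos_pos_sub_pos (κ : ℝ) (i : F) (b : Bool) :
    Real.cos (κ * (H.pos (i, b) - H.pos (i, !b))) = Real.cos (κ * H.len i) := by
  cases b <;> simp [pos]

theorem outDeriv_of_eqOn_cos {f : F → ℝ → ℝ} {κ a : ℝ} {i : F} {b : Bool}
    (hf : ∀ x ∈ H.seg i, f i x = a * Real.cos (κ * (x - H.pos (i, !b)))) :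
    H.outDeriv f (i, b) = κ * (a * Real.sin (κ * H.len i)) := by
  cases b
  · have := edgeDeriv_of_eqOn_cos hf (zero_mem_seg i)
    simp [outDeriv, this, pos, mul_assoc]
  · have := edgeDeriv_of_eqOn_cos hf (len_mem_seg i)
    simp [outDeriv, this, pos, mul_assoc]

/-- The amplitudes at the leaves of the solutions of `Δ f = κ² f` on a star with edge lengths
`l`. -/
def starCoeff [Fintype F] (l : F → ℝ) (κ : ℝ) : Submodule ℝ (F → ℝ) where
  carrier := {a | (∀ i j, a i * Real.cos (κ * l i) = a j * Real.cos (κ * l j)) ∧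
    ∑ i, a i * Real.sin (κ * l i) = 0}
  add_mem' := by
    rintro a b ⟨ha, ha'⟩ ⟨hb, hb'⟩
    refine ⟨fun i j => ?_, ?_⟩
    · simp only [Pi.add_apply, add_mul, ha i j, hb i j]
    · simp only [Pi.add_apply, add_mul, Finset.sum_add_distrib, ha', hb', add_zero]
  zero_mem' := by simp
  smul_mem' := by
    rintro t a ⟨ha, ha'⟩
    refine ⟨fun i j => ?_, ?_⟩
    · simp only [Pi.smul_apply, smul_eq_mul, mul_assoc, ha i j]
    · simp only [Pi.smul_apply, smul_eq_mul, mul_assoc, ← Finset.mul_sum, ha', mul_zero]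

open Classical in
/-- The function on a star with prescribed amplitudes at the leaves. -/
noncomputable def starFun (H : MetricGraph W F) (o : F → Bool) (κ : ℝ) (a : F → ℝ) (i : F) (x : ℝ) : ℝ :=
  if x ∈ H.seg i then a i * Real.cos (κ * (x - H.pos (i, !o i))) else 0

theorem starFun_of_mem {κ : ℝ} {a : F → ℝ} {i : F} {x : ℝ} (hx : x ∈ H.seg i) :
    H.starFun o κ a i x = a i * Real.cos (κ * (x - H.pos (i, !o i))) := if_pos hx

theorem IsStar.starFun_mem (hH : H.IsStar c o) [Fintype F] {κ : ℝ} {a : F → ℝ}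
    (ha : a ∈ starCoeff H.len κ) : H.starFun o κ a ∈ H.eigenspace (κ ^ 2) := by
  have hcos : ∀ i, ∀ x ∈ H.seg i,
      H.starFun o κ a i x = a i * Real.cos (κ * (x - H.pos (i, !o i))) :=
    fun i x hx => starFun_of_mem hx
  have hval : ∀ i, H.endValue (H.starFun o κ a) (i, o i) = a i * Real.cos (κ * H.len i) :=
    fun i => by rw [endValue_eq, hcos i _ (pos_mem_seg _), cos_pos_sub_pos]
  refine ⟨fun e x hx => if_neg hx, hasLaplacian_of_eqOn_cos hcos ?_ ?_⟩
  · rintro ⟨i, b⟩ ⟨j, b'⟩ hh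
    by_cases hb : b = o i
    · by_cases hb' : b' = o j
      · rw [hb, hb', hval, hval, ha.1 i j]
      · have hb' : b' = !o j := by revert hb'; cases b' <;> cases o j <;> simp
        rw [hH.leaf j (i, b) (hb' ▸ hh), hb']
    · have hb : b = !o i := by revert hb; cases b <;> cases o i <;> simp
      rw [hH.leaf i (j, b') (hb ▸ hh.symm), hb]
  · intro v
    by_cases hv : v = c
    · subst hv
      rw [hH.hasSum_ends]
      simp only [fun i => outDeriv_of_eqOn_cos (hcos i), ← Finset.mul_sum, ha.2, mul_zero]
    · have : ∀ h : H.ends v, H.outDeriv (H.starFun o κ a) h = 0 := by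
        rintro ⟨⟨i, b⟩, h⟩
        rw [outDeriv_eq_zero_iff, edgeDeriv_of_eqOn_cos (hcos i) (pos_mem_seg _)]
        have hb : b = !o i := by
          have : b ≠ o i := by
            rintro rfl
            exact hv (h.symm.trans (hH.center i))
          revert this; cases b <;> cases o i <;> simp
        simp [hb]
      simp only [this]
      exact hasSum_zero

/-- Evaluation at the leaves. -/
noncomputable def leafEval (H : MetricGraph W F) (o : F → Bool) : (F → ℝ → ℝ) →ₗ[ℝ] (F → ℝ) where
  toFun f i := f i (H.pos (i, !o i))
  map_add' _ _ := rfl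
  map_smul' _ _ := rfl

theorem IsStar.eqOn_cos (hH : H.IsStar c o) {κ : ℝ} {f : F → ℝ → ℝ}
    (hf : f ∈ H.eigenspace (κ ^ 2)) (i : F) (x : ℝ) (hx : x ∈ H.seg i) :
    f i x = H.leafEval o f i * Real.cos (κ * (x - H.pos (i, !o i))) :=
  hf.2.solution_of_critical (pos_mem_seg _) hx (hH.edgeDeriv_leaf hf.2 i)

theorem IsStar.leafEval_mem (hH : H.IsStar c o) [Fintype F] {κ : ℝ} {f : F → ℝ → ℝ}
    (hf : f ∈ H.eigenspace (κ ^ 2)) : H.leafEval o f ∈ starCoeff H.len κ := by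
  have hcos := hH.eqOn_cos hf
  constructor
  · intro i j
    have := hf.2.continuous_at (i, o i) (j, o j) (by rw [hH.center, hH.center])
    rwa [endValue_eq, endValue_eq, hcos i _ (pos_mem_seg _), hcos j _ (pos_mem_seg _),
      cos_pos_sub_pos, cos_pos_sub_pos] at this
  · have := hH.hasSum_ends.1 (hf.2.kirchhoff c)
    simp only [fun i => outDeriv_of_eqOn_cos (hcos i), ← Finset.mul_sum] at this
    -- For κ = 0 the Kirchhoff condition is void, but then all the sines vanish.
    rcases mul_eq_zero.1 this with h | h
    · simp [h]
    · exact h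

/-- The derivative vanishes at each leaf, so the leaf value determines the solution on the edge;
continuity and Kirchhoff at the center are the only constraints left on these values. -/
theorem IsStar.finrank_eigenspace (hH : H.IsStar c o) [Fintype F] (κ : ℝ) :
    Module.finrank ℝ (H.eigenspace (κ ^ 2)) = Module.finrank ℝ (starCoeff H.len κ) := by
  let L : H.eigenspace (κ ^ 2) →ₗ[ℝ] starCoeff H.len κ :=
    ((H.leafEval o).domRestrict (H.eigenspace (κ ^ 2))).codRestrict (starCoeff H.len κ)
      (fun f => hH.leafEval_mem f.2)
  refine (LinearEquiv.ofBijective L ⟨?_, ?_⟩).finrank_eq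
  · intro f g hfg
    have hfg' : H.leafEval o f = H.leafEval o g := congrArg Subtype.val hfg
    refine Subtype.ext (funext fun i => funext fun x => ?_)
    by_cases hx : x ∈ H.seg i
    · rw [hH.eqOn_cos f.2 i x hx, hH.eqOn_cos g.2 i x hx, hfg']
    · rw [f.2.1 i x hx, g.2.1 i x hx]
  · intro a
    refine ⟨⟨H.starFun o κ a, hH.starFun_mem a.2⟩, Subtype.ext (funext fun i => ?_)⟩
    change H.starFun o κ a i (H.pos (i, !o i)) = a.1 i
    rw [starFun_of_mem (H := H) (pos_mem_seg (i, !o i))]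
    simp

open Classical in
-- The value at the center determines every amplitude, and for a nonzero value Kirchhoff becomes the
-- secular equation Σ tan = 0.
theorem finrank_starCoeff_of_cos_ne_zero [Fintype F] [Nonempty F] {l : F → ℝ} {κ : ℝ}
    (h : ∀ i, Real.cos (κ * l i) ≠ 0) : Module.finrank ℝ (starCoeff l κ) =
      if ∑ i, Real.tan (κ * l i) = 0 then 1 else 0 := by
  obtain ⟨i₀⟩ := ‹Nonempty F›
  set w : F → ℝ := fun i => (Real.cos (κ * l i))⁻¹ with hw
  have key : ∀ a ∈ starCoeff l κ, a = (a i₀ * Real.cos (κ * l i₀)) • w := fun a ha => by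
    funext i
    simp only [hw, Pi.smul_apply, smul_eq_mul]
    rw [← ha.1 i i₀, mul_inv_cancel_right₀ (h i)]
  have hsum : ∑ i, w i * Real.sin (κ * l i) = ∑ i, Real.tan (κ * l i) :=
    Finset.sum_congr rfl fun i _ => by rw [Real.tan_eq_sin_div_cos, hw]; ring
  split_ifs with h0
  · have hmem : w ∈ starCoeff l κ :=
      ⟨fun i j => by simp only [hw]; rw [inv_mul_cancel₀ (h i), inv_mul_cancel₀ (h j)],
        hsum.trans h0⟩
    have : starCoeff l κ = Submodule.span ℝ {w} := by
      refine le_antisymm (fun a ha => ?_) ((Submodule.span_singleton_le_iff_mem _ _).2 hmem)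
      exact Submodule.mem_span_singleton.2 ⟨_, (key a ha).symm⟩
    rw [this]
    exact finrank_span_singleton fun hz => inv_ne_zero (h i₀) (congrFun hz i₀)
  · have : starCoeff l κ = ⊥ := by
      refine (Submodule.eq_bot_iff _).2 fun a ha => ?_
      have h1 := ha.2
      rw [key a ha] at h1
      simp only [Pi.smul_apply, smul_eq_mul, mul_assoc, ← Finset.mul_sum, hsum] at h1
      rw [← mul_assoc] at h1
      rw [key a ha, (mul_eq_zero.1 h1).resolve_right h0, zero_smul]
    rw [this, finrank_bot]

open Classical in
-- One vanishing cosine forces the value 0 at the center, so the other edges have amplitude 0. On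
-- the d edges with vanishing cosine Kirchhoff says that the amplitudes sum to 0: a hyperplane in
-- ℝ^d. The form with `+ 1` avoids truncated subtraction.
theorem finrank_starCoeff_of_cos_eq_zero [Fintype F] {l : F → ℝ} {κ : ℝ}
    (h : ∀ i, Real.cos (κ * l i) = 0 → Real.sin (κ * l i) = 1)
    (hne : ∃ i, Real.cos (κ * l i) = 0) : Module.finrank ℝ (starCoeff l κ) + 1 =
      (Finset.univ.filter fun i => Real.cos (κ * l i) = 0).card := by
  set J := {i // Real.cos (κ * l i) = 0}
  obtain ⟨i₀, hi₀⟩ := hne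
  let S : (J → ℝ) →ₗ[ℝ] ℝ := ∑ j, LinearMap.proj j
  have hS : ∀ b, S b = ∑ j, b j := fun b => by simp [S]
  have hoff : ∀ a ∈ starCoeff l κ, ∀ i, Real.cos (κ * l i) ≠ 0 → a i = 0 := fun a ha i hi => by
    have := ha.1 i i₀
    rw [hi₀, mul_zero] at this
    exact (mul_eq_zero.1 this).resolve_right hi
  have hsum : ∀ a : F → ℝ, (∀ i, Real.cos (κ * l i) ≠ 0 → a i = 0) →
      ∑ i, a i * Real.sin (κ * l i) = ∑ j : J, a j := fun a ha => by
    rw [← Finset.sum_subtype (Finset.univ.filter fun i => Real.cos (κ * l i) = 0)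
      (fun i => by simp) a, Finset.sum_filter]
    refine Finset.sum_congr rfl fun i _ => ?_
    split_ifs with hi
    · rw [h i hi, mul_one]
    · rw [ha i hi, zero_mul]
  let L : starCoeff l κ →ₗ[ℝ] LinearMap.ker S :=
    ((LinearMap.funLeft ℝ ℝ (Subtype.val : J → F)).domRestrict (starCoeff l κ)).codRestrict
      (LinearMap.ker S) (fun a => by
        rw [LinearMap.mem_ker, hS]
        exact (hsum a.1 (hoff a.1 a.2)).symm.trans a.2.2)
  have hL : Function.Bijective L := by
    constructor
    · intro a b hab
      refine Subtype.ext (funext fun i => ?_)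
      by_cases hi : Real.cos (κ * l i) = 0
      · exact congrFun (congrArg Subtype.val hab) ⟨i, hi⟩
      · rw [hoff a.1 a.2 i hi, hoff b.1 b.2 i hi]
    · intro b
      let a : F → ℝ := fun i => if hi : Real.cos (κ * l i) = 0 then b.1 ⟨i, hi⟩ else 0
      have ha : ∀ i, Real.cos (κ * l i) ≠ 0 → a i = 0 := fun i hi => dif_neg hi
      have haJ : ∀ j : J, a j = b.1 j := fun j => dif_pos j.2
      have hmul : ∀ i, a i * Real.cos (κ * l i) = 0 := fun i => by
        by_cases hi : Real.cos (κ * l i) = 0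
        · rw [hi, mul_zero]
        · rw [ha i hi, zero_mul]
      refine ⟨⟨a, fun i j => by rw [hmul, hmul], ?_⟩, Subtype.ext (funext haJ)⟩
      rw [hsum a ha, Finset.sum_congr rfl fun j _ => haJ j, ← hS]
      exact b.2
  have hsurj : LinearMap.range S = ⊤ := by
    refine LinearMap.range_eq_top.2 fun t => ⟨Pi.single ⟨i₀, hi₀⟩ t, ?_⟩
    rw [hS, Finset.sum_pi_single']
    simp
  have h1 := LinearMap.finrank_range_add_finrank_ker S
  rw [hsurj, finrank_top, Module.finrank_self, Module.finrank_fintype_fun_eq_card,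
    Fintype.card_subtype] at h1
  rw [(LinearEquiv.ofBijective L hL).finrank_eq, add_comm]
  exact h1

end MetricGraph

/-! ### The tangent sum and the spectrum of a star. -/

theorem tan_lt_tan_of_lt_pi {x y : ℝ} (hx : 0 ≤ x) (hxy : x < y) (hy : y < Real.pi)
    (h : y < Real.pi / 2 ∨ Real.pi / 2 < x) : Real.tan x < Real.tan y := by
  rcases h with h | h
  · exact Real.tan_lt_tan_of_lt_of_lt_pi_div_two (by linarith [Real.pi_pos]) h hxy
  · rw [← Real.tan_sub_pi x, ← Real.tan_sub_pi y]
    exact Real.tan_lt_tan_of_lt_of_lt_pi_div_two (by linarith) (by linarith [Real.pi_pos])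
      (by linarith)

section StarSpectrum

variable {F : Type*} {l : F → ℝ} {k : ℝ}

theorem cos_mul_eq_zero_iff {s x : ℝ} (hs : 0 < s) (hx : 0 ≤ x) (hxs : x * s < Real.pi) :
    Real.cos (x * s) = 0 ↔ x = Real.pi / 2 / s := by
  rw [eq_div_iff hs.ne']
  refine ⟨fun h => ?_, fun h => by rw [h, Real.cos_pi_div_two]⟩
  have := Real.injOn_cos ⟨mul_nonneg hx hs.le, hxs.le⟩
    ⟨by positivity, by linarith [Real.pi_pos]⟩ (h.trans Real.cos_pi_div_two.symm)
  exact this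

theorem tan_mul_lt_tan_mul {s x y : ℝ} (hs : 0 < s) (hx : 0 ≤ x) (hxy : x < y)
    (hy : y * s < Real.pi) (h : y < Real.pi / 2 / s ∨ Real.pi / 2 / s < x) :
    Real.tan (x * s) < Real.tan (y * s) := by
  refine tan_lt_tan_of_lt_pi (mul_nonneg hx hs.le) (mul_lt_mul_of_pos_right hxy hs) hy ?_
  rwa [lt_div_iff₀ hs, div_lt_iff₀ hs] at h

theorem tan_mul_le_tan_mul {s x y : ℝ} (hs : 0 < s) (hx : 0 ≤ x) (hxy : x ≤ y)
    (hy : y * s < Real.pi) (h : y < Real.pi / 2 / s ∨ Real.pi / 2 / s < x) :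
    Real.tan (x * s) ≤ Real.tan (y * s) := by
  rcases hxy.eq_or_lt with rfl | hlt
  · rfl
  · exact (tan_mul_lt_tan_mul hs hx hlt hy h).le

variable [Fintype F]

theorem sum_tan_lt_sum_tan [Nonempty F] (hl : ∀ i, 0 < l i) (hk : ∀ i, k * l i < Real.pi)
    {x y : ℝ} (hx : 0 ≤ x) (hxy : x < y) (hy : y ≤ k)
    (h : ∀ i, ¬ (x ≤ Real.pi / 2 / l i ∧ Real.pi / 2 / l i ≤ y)) :
    ∑ i, Real.tan (x * l i) < ∑ i, Real.tan (y * l i) := by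
  refine Finset.sum_lt_sum_of_nonempty Finset.univ_nonempty fun i _ => ?_
  refine tan_mul_lt_tan_mul (hl i) hx hxy
    ((mul_le_mul_of_nonneg_right hy (hl i).le).trans_lt (hk i)) ?_
  by_contra! hc
  exact h i hc.symm

/-- Replaces the limit -∞ to the right of the pole q by an explicit point. -/
theorem exists_sum_tan_nonpos (hl : ∀ i, 0 < l i) (hk : ∀ i, k * l i < Real.pi) {q m : ℝ}
    (hqm : q < m) (hmk : m ≤ k) (j : F) (hj : q = Real.pi / 2 / l j)
    (hno : ∀ i, ¬ (q < Real.pi / 2 / l i ∧ Real.pi / 2 / l i ≤ m)) :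
    ∃ x, q < x ∧ x ≤ m ∧ ∑ i, Real.tan (x * l i) ≤ 0 := by
  classical
  have hq : 0 < q := by rw [hj]; have := hl j; positivity
  have hmj : m * l j < Real.pi := (mul_le_mul_of_nonneg_right hmk (hl j).le).trans_lt (hk j)
  have hqj : q * l j = Real.pi / 2 := by rw [hj, div_mul_cancel₀ _ (hl j).ne']
  have hmj' : Real.pi / 2 < m * l j := hqj ▸ mul_lt_mul_of_pos_right hqm (hl j)
  set C := ∑ i ∈ Finset.univ.erase j, Real.tan (m * l i)
  -- The witness x solves tan(x l_j) = T on the branch after the pole. T ≤ tan(m l_j) gives x ≤ m,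
  -- so the other terms sum to at most C, and T ≤ -C makes the total nonpositive.
  set T := min (-C) (Real.tan (m * l j))
  have hxl : (Real.pi + Real.arctan T) / l j * l j = Real.arctan T + Real.pi := by
    rw [div_mul_cancel₀ _ (hl j).ne', add_comm]
  have hqx : q < (Real.pi + Real.arctan T) / l j := by
    rw [lt_div_iff₀ (hl j), hqj]
    linarith [Real.neg_pi_div_two_lt_arctan T]
  have hxm : (Real.pi + Real.arctan T) / l j ≤ m := by
    rw [div_le_iff₀ (hl j)]
    have : Real.arctan T ≤ Real.arctan (Real.tan (m * l j)) :=
      Real.arctan_strictMono.monotone (min_le_right _ _)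
    rw [← Real.tan_sub_pi, Real.arctan_tan (by linarith) (by linarith)] at this
    linarith
  refine ⟨(Real.pi + Real.arctan T) / l j, hqx, hxm, ?_⟩
  rw [← Finset.add_sum_erase _ _ (Finset.mem_univ j), hxl, Real.tan_add_pi, Real.tan_arctan]
  have h1 : ∑ i ∈ Finset.univ.erase j,
      Real.tan ((Real.pi + Real.arctan T) / l j * l i) ≤ C := by
    refine Finset.sum_le_sum fun i _ => tan_mul_le_tan_mul (hl i) (hq.trans hqx).le hxm
      ((mul_le_mul_of_nonneg_right hmk (hl i).le).trans_lt (hk i)) ?_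
    rcases le_or_gt (Real.pi / 2 / l i) q with h | h
    · exact Or.inr (h.trans_lt hqx)
    · exact Or.inl (not_le.1 fun h' => hno i ⟨h, h'⟩)
  have h2 : T ≤ -C := min_le_left _ _
  linarith

/-- The mirror image to the left of the pole p, with `max` in place of `min`. -/
theorem exists_sum_tan_nonneg (hl : ∀ i, 0 < l i) (hk : ∀ i, k * l i < Real.pi) {m p : ℝ}
    (hm : 0 ≤ m) (hmp : m < p) (hpk : p ≤ k) (j : F) (hj : p = Real.pi / 2 / l j)
    (hno : ∀ i, ¬ (m ≤ Real.pi / 2 / l i ∧ Real.pi / 2 / l i < p)) :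
    ∃ x, m ≤ x ∧ x < p ∧ 0 ≤ ∑ i, Real.tan (x * l i) := by
  classical
  have hpj : p * l j = Real.pi / 2 := by rw [hj, div_mul_cancel₀ _ (hl j).ne']
  have hmj' : m * l j < Real.pi / 2 := hpj ▸ mul_lt_mul_of_pos_right hmp (hl j)
  have hmj0 : 0 ≤ m * l j := mul_nonneg hm (hl j).le
  set C := ∑ i ∈ Finset.univ.erase j, Real.tan (m * l i)
  set T := max (-C) (Real.tan (m * l j))
  have hxl : Real.arctan T / l j * l j = Real.arctan T := div_mul_cancel₀ _ (hl j).ne'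
  have hxp : Real.arctan T / l j < p := by
    rw [div_lt_iff₀ (hl j), hpj]
    exact Real.arctan_lt_pi_div_two T
  have hmx : m ≤ Real.arctan T / l j := by
    rw [le_div_iff₀ (hl j)]
    have : Real.arctan (Real.tan (m * l j)) ≤ Real.arctan T :=
      Real.arctan_strictMono.monotone (le_max_right _ _)
    rwa [Real.arctan_tan (by linarith [Real.pi_pos]) (by linarith)] at this
  refine ⟨Real.arctan T / l j, hmx, hxp, ?_⟩
  rw [← Finset.add_sum_erase _ _ (Finset.mem_univ j), hxl, Real.tan_arctan]
  have h1 : C ≤ ∑ i ∈ Finset.univ.erase j, Real.tan (Real.arctan T / l j * l i) := by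
    refine Finset.sum_le_sum fun i _ => tan_mul_le_tan_mul (hl i) hm hmx
      ((mul_le_mul_of_nonneg_right (hxp.le.trans hpk) (hl i).le).trans_lt (hk i)) ?_
    rcases le_or_gt p (Real.pi / 2 / l i) with h | h
    · exact Or.inl (hxp.trans_le h)
    · exact Or.inr (not_le.1 fun h' => hno i ⟨h', h⟩)
  have h2 : -C ≤ T := le_max_left _ _
  linarith

/-- If there is a pole before p, apply the intermediate value theorem between the last such pole and
p; otherwise take z = 0. -/
theorem exists_sum_tan_eq_zero (hl : ∀ i, 0 < l i) (hk : ∀ i, k * l i < Real.pi) {p : ℝ}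
    (hpk : p ≤ k) (j : F) (hj : p = Real.pi / 2 / l j) :
    ∃ z, 0 ≤ z ∧ z < p ∧ (∀ i, ¬ (z ≤ Real.pi / 2 / l i ∧ Real.pi / 2 / l i < p)) ∧
      ∑ i, Real.tan (z * l i) = 0 := by
  classical
  have hpole : ∀ i, 0 < Real.pi / 2 / l i := fun i => by have := hl i; positivity
  set Q := (Finset.univ.image fun i => Real.pi / 2 / l i).filter (· < p)
  by_cases hQ : Q.Nonempty
  · have hqQ := Q.max'_mem hQ
    have hmax : ∀ i, ¬ (Q.max' hQ < Real.pi / 2 / l i ∧ Real.pi / 2 / l i < p) := fun i hi =>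
      hi.1.not_ge (Q.le_max' _ (Finset.mem_filter.2
        ⟨Finset.mem_image_of_mem _ (Finset.mem_univ i), hi.2⟩))
    set q := Q.max' hQ
    obtain ⟨hq1, hqp⟩ := Finset.mem_filter.1 hqQ
    obtain ⟨i, -, hi⟩ := Finset.mem_image.1 hq1
    have hq0 : 0 < q := hi ▸ hpole i
    obtain ⟨m, hqm, hmp⟩ := exists_between hqp
    obtain ⟨x, hqx, hxm, hx⟩ := exists_sum_tan_nonpos hl hk hqm (hmp.le.trans hpk) i hi.symm
      fun i hi => hmax i ⟨hi.1, hi.2.trans_lt hmp⟩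
    obtain ⟨y, hmy, hyp, hy⟩ := exists_sum_tan_nonneg hl hk (hq0.trans hqm).le hmp hpk j hj
      fun i hi => hmax i ⟨hqm.trans_le hi.1, hi.2⟩
    have hcont : ContinuousOn (fun x => ∑ i, Real.tan (x * l i)) (Icc x y) := by
      refine continuousOn_finsetSum _ fun i _ t ht => ?_
      have ht0 : 0 ≤ t := (hq0.trans (hqx.trans_le ht.1)).le
      have htk : t * l i < Real.pi := (mul_le_mul_of_nonneg_right
        ((ht.2.trans hyp.le).trans hpk) (hl i).le).trans_lt (hk i)
      have hcos : Real.cos (t * l i) ≠ 0 := fun h => by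
        have := (cos_mul_eq_zero_iff (hl i) ht0 htk).1 h
        exact hmax i ⟨this ▸ hqx.trans_le ht.1, this ▸ ht.2.trans_lt hyp⟩
      exact ((Real.continuousAt_tan.2 hcos).comp (f := fun t => t * l i)
        (by fun_prop)).continuousWithinAt
    obtain ⟨z, hz, hz0⟩ := intermediate_value_Icc (hxm.trans hmy) hcont ⟨hx, hy⟩
    exact ⟨z, (hq0.trans (hqx.trans_le hz.1)).le, hz.2.trans_lt hyp,
      fun i hi => hmax i ⟨hqx.trans_le (hz.1.trans hi.1), hi.2⟩, hz0⟩
  · refine ⟨0, le_rfl, hj ▸ hpole j, fun i hi => hQ ⟨Real.pi / 2 / l i, Finset.mem_filter.2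
      ⟨Finset.mem_image_of_mem _ (Finset.mem_univ i), hi.2⟩⟩, by simp⟩

open MetricGraph in
/-- The number of eigenvalues of a star with edge lengths `l` below `k ^ 2`, where `k ^ 2` is an
eigenvalue with an eigenfunction that does not vanish at the center. -/
theorem finsum_finrank_starCoeff [Nonempty F] (hl : ∀ i, 0 < l i)
    (hk : ∀ i, k * l i < Real.pi) (hk0 : 0 < k) (hcos : ∀ i, Real.cos (k * l i) ≠ 0)
    (htan : ∑ i, Real.tan (k * l i) = 0) :
    ∑ᶠ κ ∈ Ico 0 k, Module.finrank ℝ (starCoeff l κ) =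
      (Finset.univ.filter fun i => Real.pi / 2 < k * l i).card := by
  classical
  have hpole : ∀ i, 0 < Real.pi / 2 / l i := fun i => by have := hl i; positivity
  set M := Finset.univ.filter fun i => Real.pi / 2 < k * l i
  have hM : ∀ i, i ∈ M ↔ Real.pi / 2 / l i < k := fun i => by
    rw [Finset.mem_filter_univ, div_lt_iff₀ (hl i)]
  set P := M.image fun i => Real.pi / 2 / l i
  have hP : ∀ p ∈ P, p < k ∧ ∃ i, p = Real.pi / 2 / l i := fun p hp => by
    obtain ⟨i, hi, rfl⟩ := Finset.mem_image.1 hp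
    exact ⟨(hM i).1 hi, i, rfl⟩
  have hPmem : ∀ i, Real.pi / 2 / l i < k → Real.pi / 2 / l i ∈ P := fun i hi =>
    Finset.mem_image_of_mem _ ((hM i).2 hi)
  have hPk : ∀ i, Real.pi / 2 / l i ≠ k := fun i hi =>
    hcos i ((cos_mul_eq_zero_iff (hl i) hk0.le (hk i)).2 hi.symm)
  have hlt : ∀ {κ : ℝ}, κ < k → ∀ i, κ * l i < Real.pi := fun h i =>
    (mul_le_mul_of_nonneg_right h.le (hl i).le).trans_lt (hk i)
  have hz : ∀ p : P, ∃ z : ℝ, 0 ≤ z ∧ z < p.1 ∧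
      (∀ i, ¬ (z ≤ Real.pi / 2 / l i ∧ Real.pi / 2 / l i < p)) ∧
      ∑ i, Real.tan (z * l i) = 0 := fun p => by
    obtain ⟨h1, i, hi⟩ := hP p p.2
    exact exists_sum_tan_eq_zero hl hk h1.le i hi
  choose z hz0 hzp hzno hzsum using hz
  have hzP : ∀ p p' : P, z p ≠ p'.1 := fun p p' h => by
    obtain ⟨-, i, hi⟩ := hP p' p'.2
    exact hzno p i ⟨h.le.trans hi.le, hi ▸ h ▸ hzp p⟩
  have hzinj : Function.Injective z := by
    have aux : ∀ p p' : P, z p = z p' → ¬ p.1 < p'.1 := fun p p' h hlt => by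
      obtain ⟨-, i, hi⟩ := hP p p.2
      exact hzno p' i ⟨h ▸ hi ▸ (hzp p).le, hi ▸ hlt⟩
    exact fun p p' h => Subtype.ext (le_antisymm (not_lt.1 (aux p' p h.symm))
      (not_lt.1 (aux p p' h)))
  set Z := Finset.univ.image z
  have hZcard : Z.card = P.card := by
    rw [Finset.card_image_of_injective _ hzinj, Finset.card_univ, Fintype.card_coe]
  have hdisj : Disjoint P Z := Finset.disjoint_left.2 fun p hp hpZ => by
    obtain ⟨p', -, h⟩ := Finset.mem_image.1 hpZ
    exact hzP p' ⟨p, hp⟩ h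
  -- Some pole lies between κ and k, since otherwise the sum would increase strictly from the zero κ
  -- to the zero k. Then κ and `z p`, for the next pole p, lie on one pole-free interval and
  -- coincide by monotonicity.
  have hZall : ∀ κ ∈ Ico 0 k, κ ∉ P → ∑ i, Real.tan (κ * l i) = 0 → κ ∈ Z := by
    intro κ hκ hκP hκ0
    have hne : (P.filter (κ < ·)).Nonempty := by
      by_contra hempty
      refine (sum_tan_lt_sum_tan hl hk hκ.1 hκ.2 le_rfl fun i hi => hempty ?_).ne
        (hκ0.trans htan.symm)
      have hiP := hPmem i (lt_of_le_of_ne hi.2 (hPk i))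
      exact ⟨_, Finset.mem_filter.2 ⟨hiP, lt_of_le_of_ne hi.1 fun h => hκP (h ▸ hiP)⟩⟩
    have hp := Finset.min'_mem _ hne
    have hpmin : ∀ i, ¬ (κ ≤ Real.pi / 2 / l i ∧ Real.pi / 2 / l i < (P.filter (κ < ·)).min' hne) :=
      fun i hi => by
        have hiP := hPmem i (hi.2.trans (hP _ (Finset.mem_filter.1 hp).1).1)
        exact hi.2.not_ge (Finset.min'_le _ _ (Finset.mem_filter.2
          ⟨hiP, lt_of_le_of_ne hi.1 fun h => hκP (h ▸ hiP)⟩))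
    set p := (P.filter (κ < ·)).min' hne
    obtain ⟨hpP, hκp⟩ := Finset.mem_filter.1 hp
    have hpk := (hP p hpP).1
    refine Finset.mem_image.2 ⟨⟨p, hpP⟩, Finset.mem_univ _, ?_⟩
    have h1 := hzno ⟨p, hpP⟩
    have h2 := hzp ⟨p, hpP⟩
    rcases lt_trichotomy (z ⟨p, hpP⟩) κ with h | h | h
    · exact ((sum_tan_lt_sum_tan hl hk (hz0 _) h hκ.2.le fun i hi =>
        h1 i ⟨hi.1, hi.2.trans_lt hκp⟩).ne ((hzsum _).trans hκ0.symm)).elim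
    · exact h
    · exact ((sum_tan_lt_sum_tan hl hk hκ.1 h (h2.le.trans hpk.le) fun i hi =>
        hpmin i ⟨hi.1, hi.2.trans_lt h2⟩).ne (hκ0.trans (hzsum _).symm)).elim
  have hcosP : ∀ κ ∈ Ico 0 k, κ ∉ P → ∀ i, Real.cos (κ * l i) ≠ 0 := fun κ hκ hκP i h => by
    have := (cos_mul_eq_zero_iff (hl i) hκ.1 (hlt hκ.2 i)).1 h
    exact hκP (this ▸ hPmem i (this ▸ hκ.2))
  -- Only poles and chosen zeros contribute. This finiteness matters, as `finsum` is 0 on an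
  -- infinite support.
  have hsupp : Ico 0 k ∩ Function.support (fun κ => Module.finrank ℝ (starCoeff l κ)) =
      ↑(P ∪ Z) ∩ Function.support (fun κ => Module.finrank ℝ (starCoeff l κ)) := by
    ext κ
    simp only [mem_inter_iff, Finset.coe_union, mem_union, Finset.mem_coe,
      and_congr_left_iff, Function.mem_support]
    intro hκs
    constructor
    · intro hκ
      by_contra! hc
      rw [finrank_starCoeff_of_cos_ne_zero (hcosP κ hκ hc.1), if_neg fun h =>
        hc.2 (hZall κ hκ hc.1 h)] at hκs
      exact hκs rfl
    · rintro (h | h)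
      · obtain ⟨h1, i, rfl⟩ := hP κ h
        exact ⟨(hpole i).le, h1⟩
      · obtain ⟨p, -, rfl⟩ := Finset.mem_image.1 h
        exact ⟨hz0 p, (hzp p).trans (hP p p.2).1⟩
  rw [finsum_mem_eq_sum_of_inter_support_eq _ hsupp, Finset.sum_union hdisj]
  have hZsum : ∑ κ ∈ Z, Module.finrank ℝ (starCoeff l κ) = P.card := by
    rw [← hZcard, Finset.card_eq_sum_ones]
    refine Finset.sum_congr rfl fun κ hκ => ?_
    have hκP : κ ∉ P := Finset.disjoint_right.1 hdisj hκ
    obtain ⟨p, -, rfl⟩ := Finset.mem_image.1 hκ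
    rw [finrank_starCoeff_of_cos_ne_zero
      (hcosP _ ⟨hz0 p, (hzp p).trans (hP p p.2).1⟩ hκP), if_pos (hzsum p)]
  -- Each pole is paired with the zero before it; multiplicity plus 1 is the number of edges sharing
  -- the pole.
  rw [hZsum, Finset.card_eq_sum_ones, ← Finset.sum_add_distrib,
    Finset.card_eq_sum_card_image (fun i => Real.pi / 2 / l i) M]
  refine Finset.sum_congr rfl fun κ hκ => ?_
  obtain ⟨hκk, j, hj⟩ := hP κ hκ
  have hκ0 : 0 ≤ κ := hj ▸ (hpole j).le
  have hiff := fun i => cos_mul_eq_zero_iff (hl i) hκ0 (hlt hκk i)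
  rw [finrank_starCoeff_of_cos_eq_zero (fun i hi => ?_) ⟨j, (hiff j).2 hj⟩]
  · congr 1
    ext i
    rw [Finset.mem_filter_univ, Finset.mem_filter, hiff, eq_comm]
    exact ⟨fun h => ⟨(hM i).2 (h ▸ hκk), h⟩, fun h => h.2⟩
  · rw [(hiff i).1 hi, div_mul_cancel₀ _ (hl i).ne', Real.sin_pi_div_two]

namespace MetricGraph

variable {W : Type*} {H : MetricGraph W F} {c : W} {o : F → Bool}

theorem IsStar.spectralPosition_eq (hH : H.IsStar c o)
    (hk : ∀ i, k * H.len i < Real.pi) (hk0 : 0 < k) (hcos : ∀ i, Real.cos (k * H.len i) ≠ 0)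
    (htan : ∑ i, Real.tan (k * H.len i) = 0) :
    H.spectralPosition (k ^ 2) = (Finset.univ.filter fun i => Real.pi / 2 < k * H.len i).card := by
  have hbij : BijOn (fun κ : ℝ => κ ^ 2) (Ico 0 k) (Ico 0 (k ^ 2)) := by
    refine ⟨fun κ hκ => ⟨sq_nonneg κ, pow_lt_pow_left₀ hκ.2 hκ.1 two_ne_zero⟩,
      fun κ hκ κ' hκ' h => (sq_eq_sq₀ hκ.1 hκ'.1).1 h, fun μ hμ => ?_⟩
    exact ⟨√μ, ⟨Real.sqrt_nonneg μ, (Real.sqrt_lt' hk0).2 hμ.2⟩, Real.sq_sqrt hμ.1⟩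
  unfold spectralPosition
  rw [← finsum_mem_eq_of_bijOn (f := fun κ => Module.finrank ℝ (starCoeff H.len κ)) _ hbij
    fun κ _ => (hH.finrank_eigenspace κ).symm]
  rcases isEmpty_or_nonempty F with hF | hF
  · have : ∀ κ : ℝ, Module.finrank ℝ (starCoeff H.len κ) = 0 := fun κ =>
      Module.finrank_zero_of_subsingleton
    simp [this]
  · exact finsum_finrank_starCoeff H.len_pos hk hk0 hcos htan

end MetricGraph

end StarSpectrum

/-! ### Cutting every edge decomposes the graph into stars. -/

namespace MetricGraph

variable {V E : Type*} {G : MetricGraph V E} {S : Set (E × ℝ)} {a b : E → ℝ}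

theorem eq_of_reachable_of_edge {α : Type*} (φ : V → α) (h : ∀ e, φ (G.src e) = φ (G.tgt e))
    {u v : V} (huv : G.toSimple.Reachable u v) : φ u = φ v := by
  rw [SimpleGraph.reachable_iff_reflTransGen] at huv
  induction huv with
  | refl => rfl
  | tail _ hadj ih =>
    rw [ih]
    rcases hadj with ⟨-, ⟨e, rfl, rfl⟩ | ⟨e, rfl, rfl⟩⟩
    · exact h e
    · exact (h e).symm

/-- Every edge `e` is cut by `S`, and `a e`, `b e` are the first and the last cut point on `e`. -/
structure IsCutBetween (G : MetricGraph V E) (S : Set (E × ℝ)) (a b : E → ℝ) : Prop where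
  mem_Ioo : ∀ p ∈ S, p.2 ∈ Ioo 0 (G.len p.1)
  isLeast : ∀ e, IsLeast {x | (e, x) ∈ S} (a e)
  isGreatest : ∀ e, IsGreatest {x | (e, x) ∈ S} (b e)

theorem zero_mem_cutCoords (e : E) : 0 ∈ G.cutCoords S e := Or.inl (Or.inl rfl)

theorem len_mem_cutCoords (e : E) : G.len e ∈ G.cutCoords S e := Or.inl (Or.inr rfl)

theorem mem_cutCoords_of_mem {e : E} {x : ℝ} (h : (e, x) ∈ S) : x ∈ G.cutCoords S e := Or.inr h

theorem IsCutBetween.mem_cutCoords (hS : G.IsCutBetween S a b) {e : E} {x : ℝ}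
    (hx : x ∈ G.cutCoords S e) : x = 0 ∨ x = G.len e ∨ a e ≤ x ∧ x ≤ b e ∧ (e, x) ∈ S := by
  rcases hx with (h | h) | h
  · exact Or.inl h
  · exact Or.inr (Or.inl h)
  · exact Or.inr (Or.inr ⟨(hS.isLeast e).2 h, (hS.isGreatest e).2 h, h⟩)

/-- The piece at an edge end. -/
def endPiece (hS : G.IsCutBetween S a b) : E × Bool → G.CutEdge S
  | (e, false) => ⟨(e, 0, a e), zero_mem_cutCoords e, mem_cutCoords_of_mem (hS.isLeast e).1,
      (hS.mem_Ioo _ (hS.isLeast e).1).1, fun y hy h => by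
        have := (hS.mem_Ioo _ (hS.isLeast e).1).2
        rcases hS.mem_cutCoords hy with h' | h' | h'
        · exact h.1.ne' h'
        · exact (h' ▸ h.2).not_gt this
        · exact h.2.not_ge h'.1⟩
  | (e, true) => ⟨(e, b e, G.len e), mem_cutCoords_of_mem (hS.isGreatest e).1,
      len_mem_cutCoords e, (hS.mem_Ioo _ (hS.isGreatest e).1).2, fun y hy h => by
        have := (hS.mem_Ioo _ (hS.isGreatest e).1).1
        rcases hS.mem_cutCoords hy with h' | h' | h'
        · exact (h' ▸ h.1).not_gt this
        · exact h.2.ne h'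
        · exact h.1.not_ge h'.2.1⟩

theorem endPiece_injective (hS : G.IsCutBetween S a b) : Function.Injective (G.endPiece hS) := by
  have h0 : ∀ e, b e ≠ 0 := fun e => (hS.mem_Ioo _ (hS.isGreatest e).1).1.ne'
  rintro ⟨e, _ | _⟩ ⟨e', _ | _⟩ h
  all_goals
    have h := congrArg Subtype.val h
    simp only [endPiece, Prod.mk.injEq] at h
  · rw [h.1]
  · exact (h0 _ h.2.1.symm).elim
  · exact (h0 _ h.2.1).elim
  · rw [h.1]

/-- The cut point next to an edge end. -/
def endPoint (hS : G.IsCutBetween S a b) : E × Bool → S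
  | (e, false) => ⟨(e, a e), (hS.isLeast e).1⟩
  | (e, true) => ⟨(e, b e), (hS.isGreatest e).1⟩

/-- The length of the piece at an edge end. -/
def endLength (G : MetricGraph V E) (a b : E → ℝ) (h : E × Bool) : ℝ :=
  if h.2 then G.len h.1 - b h.1 else a h.1

theorem cut_len_endPiece (hS : G.IsCutBetween S a b) (h : E × Bool) :
    (G.cut S).len (G.endPiece hS h) = G.endLength a b h := by
  rcases h with ⟨e, _ | _⟩ <;> simp [cut, endPiece, endLength]

theorem cut_vert_endPiece (hS : G.IsCutBetween S a b) (h : E × Bool) :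
    (G.cut S).vert (G.endPiece hS h, h.2) = Sum.inl (G.vert h) := by
  rcases h with ⟨e, _ | _⟩
  · have : (e, (0 : ℝ)) ∉ S := fun h => (hS.mem_Ioo _ h).1.false
    simp [vert, cut, endPiece, this]
  · have : (e, G.len e) ∉ S := fun h => (hS.mem_Ioo _ h).2.false
    simp [vert, cut, endPiece, this]

theorem cut_vert_endPiece_not (hS : G.IsCutBetween S a b) (h : E × Bool) :
    (G.cut S).vert (G.endPiece hS h, !h.2) = Sum.inr (G.endPoint hS h, h.2) := by
  rcases h with ⟨e, _ | _⟩
  · have : (e, a e) ∈ S := (hS.isLeast e).1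
    simp [vert, cut, endPiece, this, endPoint]
  · have : (e, b e) ∈ S := (hS.isGreatest e).1
    simp [vert, cut, endPiece, this, endPoint]

theorem CutEdge.ext_left {q q' : G.CutEdge S} (h : q.1.1 = q'.1.1)
    (h' : q.1.2.1 = q'.1.2.1) : q = q' := by
  obtain ⟨⟨e, x, y⟩, hx, hy, hxy, hq⟩ := q
  obtain ⟨⟨e', x', y'⟩, hx', hy', hxy', hq'⟩ := q'
  obtain rfl : e = e' := h
  obtain rfl : x = x' := h'
  have : y = y' := le_antisymm (not_lt.1 fun h => hq y' hy' ⟨hxy', h⟩)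
    (not_lt.1 fun h => hq' y hy ⟨hxy, h⟩)
  subst this
  rfl

theorem CutEdge.ext_right {q q' : G.CutEdge S} (h : q.1.1 = q'.1.1)
    (h' : q.1.2.2 = q'.1.2.2) : q = q' := by
  obtain ⟨⟨e, x, y⟩, hx, hy, hxy, hq⟩ := q
  obtain ⟨⟨e', x', y'⟩, hx', hy', hxy', hq'⟩ := q'
  obtain rfl : e = e' := h
  obtain rfl : y = y' := h'
  have : x = x' := le_antisymm (not_lt.1 fun h => hq' x hx ⟨h, hxy⟩)
    (not_lt.1 fun h => hq x' hx' ⟨h, hxy'⟩)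
  subst this
  rfl

theorem cut_vert_eq_inr {q : G.CutEdge S} {c : Bool} {z : S × Bool}
    (h : (G.cut S).vert (q, c) = Sum.inr z) :
    z.2 = !c ∧ q.1.1 = z.1.1.1 ∧ (if c then q.1.2.2 else q.1.2.1) = z.1.1.2 := by
  cases c <;> simp only [vert, cut, Bool.false_eq_true, if_true, if_false] at h <;> split_ifs at h
  all_goals
    have h := Sum.inr.inj h
    subst h
    simp

/-- Only one piece ends at each copy of a cut point. -/
theorem cut_vert_inr_unique {h h' : G.CutEdge S × Bool} {z : S × Bool}
    (hz : (G.cut S).vert h = Sum.inr z) (hz' : (G.cut S).vert h' = Sum.inr z) : h = h' := by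
  obtain ⟨q, c⟩ := h
  obtain ⟨q', c'⟩ := h'
  obtain ⟨h1, h2, h3⟩ := cut_vert_eq_inr hz
  obtain ⟨h1', h2', h3'⟩ := cut_vert_eq_inr hz'
  obtain rfl : c = c' := Bool.not_inj (h1.symm.trans h1')
  refine Prod.ext ?_ rfl
  cases c
  · exact CutEdge.ext_left (h2.trans h2'.symm) (h3.trans h3'.symm)
  · exact CutEdge.ext_right (h2.trans h2'.symm) (h3.trans h3'.symm)

open Classical in
/-- The original vertex in the component of a vertex of the cut graph, if there is one. -/
noncomputable def cutColor (G : MetricGraph V E) (S : Set (E × ℝ)) (a b : E → ℝ) :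
    V ⊕ (S × Bool) → Option V
  | Sum.inl v => some v
  | Sum.inr (p, false) => if p.1.2 = a p.1.1 then some (G.src p.1.1) else none
  | Sum.inr (p, true) => if p.1.2 = b p.1.1 then some (G.tgt p.1.1) else none

theorem cutColor_endPoint (hS : G.IsCutBetween S a b) (h : E × Bool) :
    G.cutColor S a b (Sum.inr (G.endPoint hS h, h.2)) = some (G.vert h) := by
  rcases h with ⟨e, _ | _⟩ <;> simp [cutColor, endPoint, vert]

/-- A piece between two cut points starts before the last one and ends after the first one, so
neither of its ends is coloured. -/
theorem cutEdge_cases (hS : G.IsCutBetween S a b) (q : G.CutEdge S) :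
    (∃ h, q = G.endPiece hS h) ∨ G.cutColor S a b ((G.cut S).src q) = none ∧
      G.cutColor S a b ((G.cut S).tgt q) = none := by
  obtain ⟨⟨e, x, y⟩, hx, hy, hxy, hq⟩ := q
  simp only at hx hy hxy hq
  rcases hS.mem_cutCoords hx with h | h | h
  · exact Or.inl ⟨(e, false), CutEdge.ext_left rfl h⟩
  · exfalso
    subst h
    have := hS.mem_Ioo _ (hS.isGreatest e).1
    rcases hS.mem_cutCoords hy with h' | h' | h'
    · linarith [G.len_pos e]
    · exact hxy.ne' h'
    · linarith [this.2, h'.2.1]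
  · rcases hS.mem_cutCoords hy with h' | h' | h'
    · have := (hS.mem_Ioo _ h.2.2).1
      exact absurd (h' ▸ hxy) this.not_gt
    · exact Or.inl ⟨(e, true), CutEdge.ext_right rfl h'⟩
    · right
      have h1 : x ≠ b e := (hxy.trans_le h'.2.1).ne
      have h2 : y ≠ a e := (h.1.trans_lt hxy).ne'
      simp [cut, h.2.2, h'.2.2, cutColor, h1, h2]

theorem cutColor_vert_endPiece (hS : G.IsCutBetween S a b) (h : E × Bool) (c : Bool) :
    G.cutColor S a b ((G.cut S).vert (G.endPiece hS h, c)) = some (G.vert h) := by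
  by_cases hc : c = h.2
  · rw [hc, cut_vert_endPiece]
    rfl
  · have hc : c = !h.2 := by revert hc; cases c <;> cases h.2 <;> simp
    rw [hc, cut_vert_endPiece_not, cutColor_endPoint]

theorem cutColor_src_eq_tgt (hS : G.IsCutBetween S a b) (q : G.CutEdge S) :
    G.cutColor S a b ((G.cut S).src q) = G.cutColor S a b ((G.cut S).tgt q) := by
  rcases cutEdge_cases hS q with ⟨h, rfl⟩ | ⟨h1, h2⟩
  · exact (cutColor_vert_endPiece hS h false).trans (cutColor_vert_endPiece hS h true).symm
  · rw [h1, h2]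

/-- `cutColor` is constant along pieces, hence on components, and it separates the original
vertices. -/
theorem eq_of_reachable_cut (hS : G.IsCutBetween S a b) {u v : V}
    (h : (G.cut S).toSimple.Reachable (Sum.inl u) (Sum.inl v)) : u = v :=
  Option.some.inj (eq_of_reachable_of_edge (G.cutColor S a b) (cutColor_src_eq_tgt hS) h)

theorem reachable_cut_src_iff (hS : G.IsCutBetween S a b) (v : V) (q : G.CutEdge S) :
    (G.cut S).toSimple.Reachable (Sum.inl v) ((G.cut S).src q) ↔
      ∃ h ∈ G.ends v, q = G.endPiece hS h := by
  constructor
  · intro hr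
    have hcol := eq_of_reachable_of_edge (G.cutColor S a b) (cutColor_src_eq_tgt hS) hr
    rcases cutEdge_cases hS q with ⟨h, rfl⟩ | ⟨h1, -⟩
    · refine ⟨h, ?_, rfl⟩
      have h2 := cutColor_vert_endPiece hS h false
      exact (Option.some.inj (hcol.trans h2)).symm
    · rw [h1] at hcol
      exact (Option.some_ne_none v hcol).elim
  · rintro ⟨h, rfl, rfl⟩
    have hv := cut_vert_endPiece hS h
    rcases h with ⟨e, _ | _⟩
    · exact hv ▸ SimpleGraph.Reachable.refl _
    · refine hv ▸ SimpleGraph.Reachable.symm (reachable_tgt _ (SimpleGraph.Reachable.refl _))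

/-- The edges of the component of `v` in the cut graph are the pieces at `v`. -/
noncomputable def componentEdgeEquiv (hS : G.IsCutBetween S a b) (v : V) :
    G.ends v ≃ {q // (G.cut S).toSimple.Reachable (Sum.inl v) ((G.cut S).src q)} :=
  Equiv.ofBijective
    (fun h => ⟨G.endPiece hS h, (reachable_cut_src_iff hS v _).2 ⟨h, h.2, rfl⟩⟩) <| by
      refine ⟨fun h h' hh => Subtype.ext (endPiece_injective hS (congrArg Subtype.val hh)), ?_⟩
      rintro ⟨q, hq⟩
      obtain ⟨h, hv, rfl⟩ := (reachable_cut_src_iff hS v q).1 hq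
      exact ⟨⟨h, hv⟩, rfl⟩

theorem component_vert_val {V' E' : Type*} (H : MetricGraph V' E') (v : V')
    (q : {e // H.toSimple.Reachable v (H.src e)}) (c : Bool) :
    ((H.component v).vert (q, c)).1 = H.vert (q.1, c) := by
  cases c <;> rfl

/-- Every piece at v ends at its own copy of a cut point, where no other piece ends. A loop at v
contributes two edges of the star. -/
theorem isStar_component_cut (hS : G.IsCutBetween S a b) (v : V) :
    ((G.cut S).component (Sum.inl v)).IsStar ⟨Sum.inl v, SimpleGraph.Reachable.refl _⟩
      (fun q => ((componentEdgeEquiv hS v).symm q).1.2) := by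
  constructor
  · intro q
    obtain ⟨h, rfl⟩ := (componentEdgeEquiv hS v).surjective q
    rw [Equiv.symm_apply_apply]
    refine Subtype.ext ((component_vert_val _ _ _ _).trans ?_)
    exact (cut_vert_endPiece hS h.1).trans (congrArg Sum.inl h.2)
  · intro q h' hh
    obtain ⟨h, rfl⟩ := (componentEdgeEquiv hS v).surjective q
    rw [Equiv.symm_apply_apply] at hh ⊢
    have hh := congrArg Subtype.val hh
    rw [component_vert_val, component_vert_val] at hh
    have h1 := cut_vert_endPiece_not hS h.1
    have h2 := cut_vert_inr_unique (hh.trans h1) h1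
    exact Prod.ext (Subtype.ext (congrArg (fun p => p.1) h2)) (congrArg (fun p => p.2) h2)

theorem component_cut_len (hS : G.IsCutBetween S a b) (v : V) (h : G.ends v) :
    ((G.cut S).component (Sum.inl v)).len (componentEdgeEquiv hS v h) = G.endLength a b h :=
  cut_len_endPiece hS h

open Classical in
theorem component_cut_totalLength [Fintype E] (hS : G.IsCutBetween S a b) (v : V) :
    ((G.cut S).component (Sum.inl v)).totalLength = ∑ h : G.ends v, G.endLength a b h := by
  unfold totalLength
  rw [← finsum_comp_equiv (componentEdgeEquiv hS v), finsum_eq_sum_of_fintype]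
  exact Finset.sum_congr rfl fun h _ => component_cut_len hS v h

open Classical in
theorem component_cut_spectralPosition [Fintype E] (hS : G.IsCutBetween S a b) (v : V) {k : ℝ}
    (hk0 : 0 < k) (hk : ∀ h ∈ G.ends v, k * G.endLength a b h < Real.pi)
    (hcos : ∀ h ∈ G.ends v, Real.cos (k * G.endLength a b h) ≠ 0)
    (htan : ∑ h : G.ends v, Real.tan (k * G.endLength a b h) = 0) :
    ((G.cut S).component (Sum.inl v)).spectralPosition (k ^ 2) =
      ∑ h : G.ends v, if Real.pi / 2 < k * G.endLength a b h then 1 else 0 := by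
  let φ := componentEdgeEquiv hS v
  have : Fintype {q // (G.cut S).toSimple.Reachable (Sum.inl v) ((G.cut S).src q)} :=
    Fintype.ofEquiv _ φ
  have hall : ∀ {P : ℝ → Prop}, (∀ h ∈ G.ends v, P (G.endLength a b h)) →
      ∀ q, P (((G.cut S).component (Sum.inl v)).len q) := fun hP q => by
    obtain ⟨h, rfl⟩ := φ.surjective q
    rw [component_cut_len]
    exact hP h h.2
  rw [(isStar_component_cut hS v).spectralPosition_eq (hall (P := fun x => k * x < Real.pi) hk) hk0
    (hall (P := fun x => Real.cos (k * x) ≠ 0) hcos), Finset.card_filter, ← φ.sum_comp]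
  · simp only [φ, component_cut_len]
  · rw [← φ.sum_comp]
    simpa only [φ, component_cut_len] using htan

end MetricGraph

/-! ### Zeros of a cosine and of its derivative on one edge. -/

theorem exists_phase {k A B : ℝ} (hk : 0 < k) (hA : A ≠ 0) :
    ∃ R a : ℝ, R ≠ 0 ∧ 0 < a ∧ k * a ≤ Real.pi ∧ A = R * Real.cos (k * a) ∧
      B = R * Real.sin (k * a) := by
  set z : ℂ := ⟨A, B⟩
  have hz : z ≠ 0 := fun h => hA (congrArg Complex.re h)
  have hn : ‖z‖ ≠ 0 := norm_ne_zero_iff.2 hz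
  have hre : A = ‖z‖ * Real.cos z.arg := (Complex.norm_mul_cos_arg z).symm
  have him : B = ‖z‖ * Real.sin z.arg := (Complex.norm_mul_sin_arg z).symm
  rcases lt_or_ge 0 z.arg with h | h
  · refine ⟨‖z‖, z.arg / k, hn, div_pos h hk, ?_⟩
    rw [mul_div_cancel₀ _ hk.ne']
    exact ⟨Complex.arg_le_pi z, hre, him⟩
  -- A sign change of R shifts the phase into (0, π]. For B = 0 this gives ka = π, never 0, so a
  -- critical end of the edge is not taken for an inner Neumann point.
  · have h1 := Complex.neg_pi_lt_arg z
    refine ⟨-‖z‖, (z.arg + Real.pi) / k, neg_ne_zero.2 hn, div_pos (by linarith) hk, ?_⟩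
    rw [mul_div_cancel₀ _ hk.ne', Real.cos_add_pi, Real.sin_add_pi, neg_mul_neg, neg_mul_neg]
    exact ⟨by linarith, hre, him⟩

section Counting

variable {k a L : ℝ} {m : ℕ}

theorem setOf_sin_eq_zero (hk : 0 < k) (ha : 0 < a) (hka : k * a ≤ Real.pi)
    (h1 : k * a + m * Real.pi < k * L) (h2 : k * L ≤ k * a + (m + 1) * Real.pi) :
    {x | x ∈ Ioo 0 L ∧ Real.sin (k * (x - a)) = 0} =
      (fun j : ℕ => a + j * Real.pi / k) '' (Finset.range (m + 1) : Finset ℕ) := by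
  have hpi := Real.pi_pos
  ext x
  simp only [mem_ofPred_eq, mem_image, Finset.mem_coe, Finset.mem_range]
  constructor
  · rintro ⟨⟨hx0, hxL⟩, hs⟩
    obtain ⟨n, hn⟩ := Real.sin_eq_zero_iff.1 hs
    have hx0' : 0 < k * x := mul_pos hk hx0
    have hxL' : k * x < k * L := mul_lt_mul_of_pos_left hxL hk
    have hn0 : -1 < (n : ℝ) := lt_of_mul_lt_mul_right (a := Real.pi) (by linarith) hpi.le
    have hnm : (n : ℝ) < m + 1 := lt_of_mul_lt_mul_right (a := Real.pi) (by linarith) hpi.le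
    have hn0' : -1 < n := by exact_mod_cast hn0
    have hnm' : n < m + 1 := by exact_mod_cast hnm
    lift n to ℕ using by omega
    refine ⟨n, by omega, ?_⟩
    push_cast at hn
    rw [hn, mul_div_cancel_left₀ _ hk.ne']
    ring
  · rintro ⟨j, hj, rfl⟩
    have hjm : (j : ℝ) ≤ m := by exact_mod_cast Nat.lt_succ_iff.1 hj
    refine ⟨⟨by positivity, lt_of_mul_lt_mul_left (a := k) ?_ hk.le⟩, ?_⟩
    · rw [mul_add, mul_div_cancel₀ _ hk.ne']
      linarith [mul_le_mul_of_nonneg_right hjm hpi.le]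
    · rw [add_sub_cancel_left, mul_div_cancel₀ _ hk.ne', Real.sin_nat_mul_pi]

theorem setOf_cos_eq_zero (hk : 0 < k) (hka : k * a ≤ Real.pi)
    (h2 : k * L ≤ k * a + (m + 1) * Real.pi) :
    {x | x ∈ Ioo 0 L ∧ Real.cos (k * (x - a)) = 0} =
      (fun j : ℕ => a + (j - 1 / 2) * Real.pi / k) '' ((Finset.range (m + 2)).filter fun j : ℕ =>
        0 < k * a + (j - 1 / 2) * Real.pi ∧ k * a + (j - 1 / 2) * Real.pi < k * L : Finset ℕ) := by
  have hpi := Real.pi_pos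
  ext x
  simp only [mem_ofPred_eq, mem_image, Finset.mem_coe, Finset.mem_filter, Finset.mem_range]
  constructor
  · rintro ⟨⟨hx0, hxL⟩, hs⟩
    obtain ⟨n, hn⟩ := Real.cos_eq_zero_iff.1 hs
    have hx0' : 0 < k * x := mul_pos hk hx0
    have hxL' : k * x < k * L := mul_lt_mul_of_pos_left hxL hk
    have hn0 : -2 < (2 * n + 1 : ℝ) := lt_of_mul_lt_mul_right (a := Real.pi) (by linarith) hpi.le
    have hnm : (2 * n + 1 : ℝ) < 2 * m + 2 :=
      lt_of_mul_lt_mul_right (a := Real.pi) (by linarith) hpi.le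
    have hn0' : -2 < 2 * n + 1 := by exact_mod_cast hn0
    have hnm' : 2 * n + 1 < 2 * m + 2 := by exact_mod_cast hnm
    obtain ⟨j, hj⟩ : ∃ j : ℕ, (j : ℤ) = n + 1 := ⟨(n + 1).toNat, by omega⟩
    have hjr : (j : ℝ) = n + 1 := by exact_mod_cast hj
    have hx : k * a + (j - 1 / 2) * Real.pi = k * x := by rw [hjr]; linarith
    refine ⟨j, ⟨by omega, by rw [hx]; exact ⟨hx0', hxL'⟩⟩, ?_⟩
    refine mul_left_cancel₀ hk.ne' ?_
    rw [← hx, mul_add, mul_div_cancel₀ _ hk.ne']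
  · rintro ⟨j, ⟨-, hj0, hjL⟩, rfl⟩
    have hx : k * a + (j - 1 / 2) * Real.pi = k * (a + (j - 1 / 2) * Real.pi / k) := by
      rw [mul_add, mul_div_cancel₀ _ hk.ne']
    refine ⟨⟨pos_of_mul_pos_right (hx ▸ hj0) hk.le,
      lt_of_mul_lt_mul_left (hx ▸ hjL) hk.le⟩, ?_⟩
    rw [add_sub_cancel_left, mul_div_cancel₀ _ hk.ne', Real.cos_eq_zero_iff]
    exact ⟨j - 1, by push_cast; ring⟩

open Classical in
-- The candidates are a + (j - 1/2)π/k. Those with 1 ≤ j ≤ m lie between Neumann points; j = 0 and j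
-- = m + 1 fall into the end pieces and count only if these are longer than a quarter period.
theorem ncard_cos_eq_zero (hk : 0 < k) (ha : 0 < a) (hka : k * a ≤ Real.pi)
    (h1 : k * a + m * Real.pi < k * L) (h2 : k * L ≤ k * a + (m + 1) * Real.pi) :
    {x | x ∈ Ioo 0 L ∧ Real.cos (k * (x - a)) = 0}.ncard =
      m + (if Real.pi / 2 < k * a then 1 else 0) +
        (if Real.pi / 2 < k * (L - (a + m * Real.pi / k)) then 1 else 0) := by
  have hpi := Real.pi_pos
  have hka0 : 0 < k * a := mul_pos hk ha
  have hm0 : 0 ≤ m * Real.pi := by positivity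
  rw [setOf_cos_eq_zero hk hka h2, ncard_image_of_injective _ fun i j hij => ?_, ncard_coe_finset,
    Finset.card_filter, Finset.sum_range_succ, Finset.sum_range_succ']
  · congr 1
    · congr 1
      · rw [Finset.sum_congr rfl fun j hj => if_pos ?_]
        · simp
        · have hj : (j : ℝ) + 1 ≤ m := by exact_mod_cast Finset.mem_range.1 hj
          have hj0 : (0 : ℝ) ≤ j := j.cast_nonneg
          push_cast
          constructor
          · nlinarith
          · nlinarith
      · refine if_congr ?_ rfl rfl
        push_cast
        constructor
        · rintro ⟨h, -⟩; linarith
        · intro h; constructor <;> linarith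
    · refine if_congr ?_ rfl rfl
      rw [mul_sub, mul_add, mul_div_cancel₀ _ hk.ne']
      push_cast
      constructor
      · rintro ⟨-, h⟩; linarith
      · intro h; constructor <;> linarith
  · have h3 : (i - 1 / 2 : ℝ) * Real.pi / k = (j - 1 / 2) * Real.pi / k := add_left_cancel hij
    have h4 := mul_right_cancel₀ hpi.ne' ((div_left_inj' hk.ne').1 h3)
    exact_mod_cast sub_left_injective h4

end Counting

/-- Finiteness is essential, since `ncard` of an infinite set is 0. -/
theorem ncard_setOf_prod {E : Type*} [Fintype E] (A : E → Set ℝ) (hA : ∀ e, (A e).Finite) :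
    {p : E × ℝ | p.2 ∈ A p.1}.ncard = ∑ e, (A e).ncard := by
  have := fun e => (hA e).to_subtype
  let φ : {p : E × ℝ | p.2 ∈ A p.1} ≃ Σ e, A e :=
    { toFun := fun p => ⟨p.1.1, p.1.2, p.2⟩
      invFun := fun q => ⟨(q.1, q.2.1), q.2.2⟩
      left_inv := fun _ => rfl
      right_inv := fun _ => rfl }
  rw [← Nat.card_coe_set_eq, Nat.card_congr φ, Nat.card_sigma]
  rfl

/-! ### Cosine form on the whole graph and sums over edge ends. -/

namespace MetricGraph

variable {V E : Type*} {G : MetricGraph V E}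

/-- A function of the form `R cos (k (x - a))` on every edge, such that the first and the last
inner critical points of the edge `e` are `a e` and `a e + m e * π / k`. -/
structure IsWave (G : MetricGraph V E) (f : E → ℝ → ℝ) (k : ℝ) (R a : E → ℝ) (m : E → ℕ) :
    Prop where
  amplitude_ne_zero : ∀ e, R e ≠ 0
  pos : ∀ e, 0 < a e
  le_pi : ∀ e, k * a e ≤ Real.pi
  last_lt : ∀ e, k * a e + m e * Real.pi < k * G.len e
  len_le : ∀ e, k * G.len e ≤ k * a e + (m e + 1) * Real.pi
  eqOn : ∀ e, ∀ x ∈ G.seg e, f e x = R e * Real.cos (k * (x - a e))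

theorem HasLaplacian.exists_isWave {f : E → ℝ → ℝ} {k : ℝ} (hf : G.HasLaplacian f (k ^ 2 • f))
    (hk : 0 < k) (hlen : ∀ e, Real.pi < k * G.len e) (hval : ∀ e, f e 0 ≠ 0) :
    ∃ R a m, G.IsWave f k R a m := by
  have h := fun e => exists_phase (B := G.edgeDeriv f e 0 / k) hk (hval e)
  choose R a hR ha hka hA hB using h
  have hpi := Real.pi_pos
  have hm : ∀ e, ∃ m : ℕ, k * a e + m * Real.pi < k * G.len e ∧
      k * G.len e ≤ k * a e + (m + 1) * Real.pi := fun e => by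
    have hy : 0 < (k * G.len e - k * a e) / Real.pi :=
      div_pos (by linarith [hlen e, hka e]) hpi
    -- m is a ceiling minus 1 rather than a floor, so that a critical point at the far end is
    -- excluded and the last piece, like the first, has length in (0, π/k].
    obtain ⟨m, hm⟩ := Nat.exists_eq_succ_of_ne_zero (Nat.ceil_pos.2 hy).ne'
    have h1 := Nat.lt_ceil.1 (hm ▸ Nat.lt_succ_self m)
    have h2 := Nat.le_ceil ((k * G.len e - k * a e) / Real.pi)
    rw [hm] at h2
    push_cast at h2
    rw [lt_div_iff₀ hpi] at h1
    rw [div_le_iff₀ hpi] at h2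
    exact ⟨m, by linarith, by linarith⟩
  choose m hm1 hm2 using hm
  refine ⟨R, a, m, hR, ha, hka, hm1, hm2, fun e x hx => ?_⟩
  have h1 := (hf.solution (zero_mem_seg e) hx).1
  have h2 : G.edgeDeriv f e 0 = k * (R e * Real.sin (k * a e)) := by
    rw [← hB e, mul_div_cancel₀ _ hk.ne']
  rw [sub_zero, hA e, h2] at h1
  refine mul_left_cancel₀ hk.ne' ?_
  rw [h1, mul_sub, Real.cos_sub]
  ring

variable {f : E → ℝ → ℝ} {k : ℝ} {R a : E → ℝ} {m : E → ℕ}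

theorem IsWave.neumannPoints_eq (hw : G.IsWave f k R a m) (hk : 0 < k) :
    G.neumannPoints f = {p | p.2 ∈ {x | x ∈ Ioo 0 (G.len p.1) ∧
      Real.sin (k * (x - a p.1)) = 0}} := by
  ext ⟨e, x⟩
  refine and_congr_right fun hx => ?_
  rw [edgeDeriv_of_eqOn_cos (hw.eqOn e) ⟨hx.1.le, hx.2.le⟩]
  simp [hk.ne', hw.amplitude_ne_zero e]

theorem IsWave.nodalPoints_eq (hw : G.IsWave f k R a m) :
    G.nodalPoints f = {p | p.2 ∈ {x | x ∈ Ioo 0 (G.len p.1) ∧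
      Real.cos (k * (x - a p.1)) = 0}} := by
  ext ⟨e, x⟩
  refine and_congr_right fun hx => ?_
  rw [hw.eqOn e x ⟨hx.1.le, hx.2.le⟩]
  simp [hw.amplitude_ne_zero e]

theorem IsWave.mem_neumannPoints (hw : G.IsWave f k R a m) (hk : 0 < k) (e : E) (x : ℝ) :
    (e, x) ∈ G.neumannPoints f ↔ ∃ j : ℕ, j ≤ m e ∧ a e + j * Real.pi / k = x := by
  rw [hw.neumannPoints_eq hk]
  simp only [mem_ofPred_eq]
  change x ∈ {x | x ∈ Ioo 0 (G.len e) ∧ Real.sin (k * (x - a e)) = 0} ↔ _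
  rw [setOf_sin_eq_zero hk (hw.pos e) (hw.le_pi e) (hw.last_lt e) (hw.len_le e)]
  simp

theorem IsWave.isCutBetween (hw : G.IsWave f k R a m) (hk : 0 < k) :
    G.IsCutBetween (G.neumannPoints f) a (fun e => a e + m e * Real.pi / k) := by
  have hpi := Real.pi_pos
  refine ⟨fun p hp => hp.1, fun e => ⟨?_, fun x hx => ?_⟩, fun e => ⟨?_, fun x hx => ?_⟩⟩
  · exact (hw.mem_neumannPoints hk e _).2 ⟨0, Nat.zero_le _, by simp⟩
  · obtain ⟨j, -, rfl⟩ := (hw.mem_neumannPoints hk e _).1 hx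
    exact le_add_of_nonneg_right (by positivity)
  · exact (hw.mem_neumannPoints hk e _).2 ⟨m e, le_rfl, rfl⟩
  · obtain ⟨j, hj, rfl⟩ := (hw.mem_neumannPoints hk e _).1 hx
    have hj : (j : ℝ) ≤ m e := by exact_mod_cast hj
    change a e + j * Real.pi / k ≤ a e + m e * Real.pi / k
    gcongr

theorem IsWave.neumannCount_eq [Fintype E] (hw : G.IsWave f k R a m) (hk : 0 < k) :
    G.neumannCount f = ∑ e, (m e + 1) := by
  have h := fun e => setOf_sin_eq_zero hk (hw.pos e) (hw.le_pi e) (hw.last_lt e) (hw.len_le e)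
  unfold neumannCount
  rw [hw.neumannPoints_eq hk, ncard_setOf_prod
    (fun e => {x | x ∈ Ioo 0 (G.len e) ∧ Real.sin (k * (x - a e)) = 0})
    fun e => by rw [h e]; exact (Finset.finite_toSet _).image _]
  refine Finset.sum_congr rfl fun e _ => ?_
  rw [h e, ncard_image_of_injective _ fun i j hij => ?_, ncard_coe_finset, Finset.card_range]
  have h3 : (i : ℝ) * Real.pi / k = j * Real.pi / k := add_left_cancel hij
  exact_mod_cast mul_right_cancel₀ Real.pi_pos.ne' ((div_left_inj' hk.ne').1 h3)

open Classical in
theorem IsWave.nodalCount_add_card [Fintype E] (hw : G.IsWave f k R a m) (hk : 0 < k) :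
    G.nodalCount f + Fintype.card E = G.neumannCount f + ∑ h : E × Bool,
      if Real.pi / 2 < k * G.endLength a (fun e => a e + m e * Real.pi / k) h then 1 else 0 := by
  have h := fun e => setOf_cos_eq_zero hk (hw.le_pi e) (hw.len_le e)
  rw [hw.neumannCount_eq hk]
  unfold nodalCount
  rw [hw.nodalPoints_eq, ncard_setOf_prod
    (fun e => {x | x ∈ Ioo 0 (G.len e) ∧ Real.cos (k * (x - a e)) = 0})
    fun e => by rw [h e]; exact (Finset.finite_toSet _).image _, Fintype.sum_prod_type,
    Fintype.card_eq_sum_ones, ← Finset.sum_add_distrib, ← Finset.sum_add_distrib]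
  refine Finset.sum_congr rfl fun e _ => ?_
  rw [ncard_cos_eq_zero hk (hw.pos e) (hw.le_pi e) (hw.last_lt e) (hw.len_le e),
    Fintype.sum_bool]
  simp only [endLength, Bool.false_eq_true, if_true, if_false]
  ring

theorem IsWave.totalLength_add_card [Fintype E] (hw : G.IsWave f k R a m) (hk : 0 < k) :
    G.totalLength * k / Real.pi + Fintype.card E = G.neumannCount f + ∑ h : E × Bool,
      G.endLength a (fun e => a e + m e * Real.pi / k) h * k / Real.pi := by
  have hpi := Real.pi_pos.ne'
  rw [hw.neumannCount_eq hk]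
  unfold totalLength
  rw [finsum_eq_sum_of_fintype, Fintype.sum_prod_type, Fintype.card_eq_sum_ones, Finset.sum_mul,
    Finset.sum_div]
  push_cast
  rw [← Finset.sum_add_distrib, ← Finset.sum_add_distrib]
  refine Finset.sum_congr rfl fun e _ => ?_
  rw [Fintype.sum_bool]
  simp only [endLength, Bool.false_eq_true, if_true, if_false]
  field_simp
  ring

theorem IsWave.endLength_bounds (hw : G.IsWave f k R a m) (hk : 0 < k) (h : E × Bool) :
    0 < k * G.endLength a (fun e => a e + m e * Real.pi / k) h ∧
      k * G.endLength a (fun e => a e + m e * Real.pi / k) h ≤ Real.pi := by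
  obtain ⟨e, _ | _⟩ := h
  · exact ⟨mul_pos hk (hw.pos e), hw.le_pi e⟩
  · simp only [endLength, if_true, mul_sub, mul_add, mul_div_cancel₀ _ hk.ne']
    have h1 := hw.last_lt e
    have h2 := hw.len_le e
    constructor <;> linarith

/-- Seen from the nearest Neumann point both ends look alike: the m half periods in between only
change the amplitude by (-1)^m. -/
theorem IsWave.exists_end (hw : G.IsWave f k R a m) (hk : 0 < k) (h : E × Bool) : ∃ r, r ≠ 0 ∧
    G.endValue f h = r * Real.cos (k * G.endLength a (fun e => a e + m e * Real.pi / k) h) ∧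
    G.outDeriv f h =
      k * (r * Real.sin (k * G.endLength a (fun e => a e + m e * Real.pi / k) h)) := by
  obtain ⟨e, _ | _⟩ := h
  · refine ⟨R e, hw.amplitude_ne_zero e, ?_, ?_⟩
    · simp [endValue_eq, MetricGraph.pos, hw.eqOn e 0 (zero_mem_seg e), endLength]
    · simp [outDeriv, edgeDeriv_of_eqOn_cos (hw.eqOn e) (zero_mem_seg e), endLength, mul_assoc]
  · have hs : k * (G.len e - a e) = k * (G.len e - (a e + m e * Real.pi / k)) + m e * Real.pi := by
      field_simp
      ring
    refine ⟨R e * (-1) ^ m e, mul_ne_zero (hw.amplitude_ne_zero e) (by simp), ?_, ?_⟩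
    · simp only [endValue_eq, MetricGraph.pos, if_true, hw.eqOn e _ (len_mem_seg e), endLength]
      rw [hs, Real.cos_add_nat_mul_pi]
      ring
    · simp only [outDeriv, if_true, edgeDeriv_of_eqOn_cos (hw.eqOn e) (len_mem_seg e), endLength]
      rw [hs, Real.sin_add_nat_mul_pi]
      ring

open Classical in
-- Each tangent is an outgoing derivative divided by k times the common value at v, so this is
-- Kirchhoff at v: k satisfies the secular equation of the star at v.
theorem IsWave.sum_tan_endLength [Fintype E] (hw : G.IsWave f k R a m) (hk : 0 < k)
    {u : E → ℝ → ℝ} (hf : G.HasLaplacian f u) {v : V} (hv : ∀ h ∈ G.ends v, G.endValue f h ≠ 0) :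
    ∑ h : G.ends v, Real.tan (k * G.endLength a (fun e => a e + m e * Real.pi / k) h) = 0 := by
  rcases isEmpty_or_nonempty (G.ends v) with he | ⟨⟨h₀⟩⟩
  · simp
  · have h1 := (hasSum_fintype _).unique (hf.kirchhoff v)
    have h2 : ∀ h : G.ends v, Real.tan (k * G.endLength a (fun e => a e + m e * Real.pi / k) h) =
        G.outDeriv f h / (k * G.endValue f h₀) := fun h => by
      obtain ⟨r, hr, hval, hder⟩ := hw.exists_end hk h
      have h3 := hv h h.2
      rw [hf.continuous_at h₀ h (h₀.2.trans h.2.symm), hder, hval, Real.tan_eq_sin_div_cos,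
        mul_div_mul_left _ _ hk.ne', mul_div_mul_left _ _ hr]
    rw [Finset.sum_congr rfl fun h _ => h2 h, ← Finset.sum_div, h1, zero_div]

theorem exists_ends_eq_singleton {v : V} (hv : v ∈ G.boundary) : ∃ h, G.ends v = {h} :=
  ncard_eq_one.1 hv

/-- Kirchhoff with a single term gives sin(kℓ) = 0, and kℓ lies in (0, π]. -/
theorem IsWave.endLength_of_boundary (hw : G.IsWave f k R a m) (hk : 0 < k)
    {u : E → ℝ → ℝ} (hf : G.HasLaplacian f u) {v : V} (hv : v ∈ G.boundary) {h : E × Bool}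
    (hh : h ∈ G.ends v) :
    k * G.endLength a (fun e => a e + m e * Real.pi / k) h = Real.pi := by
  obtain ⟨h', hh'⟩ := exists_ends_eq_singleton hv
  have h1 := hasSum_single (f := fun h : G.ends v => G.outDeriv f h) ⟨h, hh⟩ fun g hg =>
    (hg (Subtype.ext ((hh' ▸ g.2 : g.1 ∈ ({h'} : Set _)).trans
      (hh' ▸ hh : h ∈ ({h'} : Set _)).symm))).elim
  have h2 : G.outDeriv f h = 0 := h1.unique (hf.kirchhoff v)
  obtain ⟨r, hr, -, hder⟩ := hw.exists_end hk h
  obtain ⟨hpos, hle⟩ := hw.endLength_bounds hk h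
  rw [hder] at h2
  refine hle.eq_of_not_lt fun hlt => (Real.sin_pos_of_pos_of_lt_pi hpos hlt).ne' ?_
  simpa [hk.ne', hr] using h2

open Classical in
theorem sum_ends_eq [Fintype V] [Fintype E] {g : E × Bool → ℝ}
    (hg : ∀ v ∈ G.boundary, ∀ h ∈ G.ends v, g h = 1) :
    ∑ h, g h = ∑ v ∈ G.interiorVertices, ∑ h : G.ends v, g h + G.boundary.ncard := by
  have h1 : ∑ h, g h = ∑ v, ∑ h : G.ends v, g h := (Fintype.sum_fiberwise G.vert g).symm
  rw [h1, ← Finset.sum_filter_add_sum_filter_not Finset.univ (fun v => v ∉ G.boundary)]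
  refine congrArg₂ (· + ·) rfl ?_
  have h2 : ∀ v ∈ Finset.univ.filter (fun v => ¬ v ∉ G.boundary), ∑ h : G.ends v, g h = 1 := by
    intro v hv
    have hv : v ∈ G.boundary := not_not.1 (Finset.mem_filter.1 hv).2
    rw [Finset.sum_congr rfl fun (h : G.ends v) _ => hg v hv h.1 h.2, Finset.sum_const, Finset.card_univ,
      nsmul_one, ← Nat.card_eq_fintype_card, Nat.card_coe_set_eq]
    rw [show (G.ends v).ncard = 1 from hv, Nat.cast_one]
  rw [Finset.sum_congr rfl h2, Finset.sum_const, nsmul_one, ← ncard_coe_finset]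
  simp

theorem pi_lt_mul_len [Finite E] {k : ℝ} (hk : Real.pi / G.minLength < k) (e : E) :
    0 < k ∧ Real.pi < k * G.len e := by
  have : Nonempty E := ⟨e⟩
  obtain ⟨e', he'⟩ := exists_eq_ciInf_of_finite (f := G.len)
  have hmin : 0 < G.minLength := by
    unfold minLength
    exact he' ▸ G.len_pos e'
  have hle : G.minLength ≤ G.len e := ciInf_le (finite_range _).bddBelow e
  have hk0 : 0 < k := (div_pos Real.pi_pos hmin).trans hk
  exact ⟨hk0, ((div_lt_iff₀ hmin).1 hk).trans_le (mul_le_mul_of_nonneg_left hle hk0.le)⟩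

end MetricGraph

/-! ### Summation over the interior vertices. -/

theorem proposition2p9 {V E : Type*} [Fintype V] [Fintype E] (G : MetricGraph V E)
    (hG : G.IsStandard) (f : ℕ → E → ℝ → ℝ) (lam : ℕ → ℝ) (hf : G.IsEigenbasis f lam)
    (k : ℕ → ℝ) (hk : ∀ m, k m = Real.sqrt (lam m))
    (n : ℕ) (hgen : G.IsGeneric (f n) (lam n)) (hkn : Real.pi / G.minLength < k n) :
    (∀ u ∈ G.interiorVertices, ∀ v ∈ G.interiorVertices,
      G.SameNeumannDomain (f n) u v → u = v) ∧
    ∑ v ∈ G.interiorVertices, (G.domainPosition (f n) (k n) v : ℤ)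
      = G.nodalSurplus (f n) n - G.neumannSurplus (f n) n
        + ((Fintype.card E : ℤ) - (G.boundary.ncard : ℤ)) ∧
    ∑ v ∈ G.interiorVertices, G.domainCapacity (f n) (k n) v
      = G.totalLength * k n / Real.pi - ((G.neumannSurplus (f n) n : ℝ) + (n : ℝ))
        + ((Fintype.card E : ℝ) - (G.boundary.ncard : ℝ)) ∧
    ∑ v ∈ G.interiorVertices,
        ((G.domainPosition (f n) (k n) v : ℝ) - G.domainCapacity (f n) (k n) v)
      = ((n : ℝ) - G.totalLength * k n / Real.pi) + (G.nodalSurplus (f n) n : ℝ) := by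
  classical
  have hpi := Real.pi_pos
  obtain ⟨e₀⟩ := hG.nonempty_edges
  have hk0 : 0 < k n := (MetricGraph.pi_lt_mul_len hkn e₀).1
  have hlam : lam n = k n ^ 2 := by
    -- `Real.sqrt` is 0 on negative numbers, so positivity of k n is what gives lam n = k n ^ 2.
    have h := hk0
    rw [hk, Real.sqrt_pos] at h
    rw [hk, Real.sq_sqrt h.le]
  have hL : G.HasLaplacian (f n) (k n ^ 2 • f n) := hlam ▸ (hf.mem_eigenspace n).2
  obtain ⟨R, a, m, hw⟩ := hL.exists_isWave hk0
    (fun e => (MetricGraph.pi_lt_mul_len hkn e).2)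
    (fun e => hgen.value_ne_zero _ (e, false) rfl)
  have hcut := hw.isCutBetween hk0
  set ℓ := G.endLength a (fun e => a e + m e * Real.pi / k n)
  have hint : ∀ v ∈ G.interiorVertices, v ∉ G.boundary := fun v hv =>
    (Finset.mem_filter.1 hv).2
  -- Genericity enters here: nonzero outgoing derivatives exclude kℓ = π, and nonzero vertex values
  -- exclude cos(kℓ) = 0.
  have hN : ∀ v ∈ G.interiorVertices, (G.domainPosition (f n) (k n) v : ℝ) =
      ∑ h : G.ends v, if Real.pi / 2 < k n * ℓ h then 1 else 0 := fun v hv => by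
    have h := MetricGraph.component_cut_spectralPosition hcut v hk0
      (fun h hh => lt_of_le_of_ne (hw.endLength_bounds hk0 h).2 fun heq => ?_)
      (fun h hh hc => ?_) (hw.sum_tan_endLength hk0 hL (hgen.value_ne_zero v))
    · refine (congrArg Nat.cast h).trans ?_
      push_cast
      rfl
    · obtain ⟨r, -, -, hder⟩ := hw.exists_end hk0 h
      refine hgen.outDeriv_ne_zero v (hint v hv) h hh ?_
      rw [hder, heq, Real.sin_pi, mul_zero, mul_zero]
    · obtain ⟨r, -, hval, -⟩ := hw.exists_end hk0 h
      refine hgen.value_ne_zero v h hh ?_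
      rw [hval, hc, mul_zero]
  have hC : ∀ v, G.domainCapacity (f n) (k n) v = ∑ h : G.ends v, ℓ h * k n / Real.pi :=
    fun v => by
      unfold MetricGraph.domainCapacity
      rw [MetricGraph.component_cut_totalLength hcut v, Finset.sum_mul, Finset.sum_div]
  have hbd : ∀ v ∈ G.boundary, ∀ h ∈ G.ends v, k n * ℓ h = Real.pi := fun v hv h hh =>
    hw.endLength_of_boundary hk0 hL hv hh
  have hsumN := MetricGraph.sum_ends_eq (G := G)
    (g := fun h => if Real.pi / 2 < k n * ℓ h then 1 else 0) fun v hv h hh => by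
      rw [hbd v hv h hh, if_pos (by linarith)]
  have hsumC := MetricGraph.sum_ends_eq (G := G) (g := fun h => ℓ h * k n / Real.pi)
    fun v hv h hh => by rw [mul_comm, hbd v hv h hh, div_self hpi.ne']
  rw [← Finset.sum_congr rfl hN] at hsumN
  rw [← Finset.sum_congr rfl fun v _ => hC v] at hsumC
  have hcount : (G.nodalCount (f n) : ℝ) + Fintype.card E = G.neumannCount (f n) +
      ∑ h : E × Bool, if Real.pi / 2 < k n * ℓ h then 1 else 0 := by
    exact_mod_cast hw.nodalCount_add_card hk0
  have hlength := hw.totalLength_add_card hk0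
  have h1 : ∑ v ∈ G.interiorVertices, (G.domainPosition (f n) (k n) v : ℝ) =
      (G.nodalCount (f n) : ℝ) - G.neumannCount (f n) +
        (Fintype.card E - (G.boundary.ncard : ℝ)) := by linarith
  have h2 : ∑ v ∈ G.interiorVertices, G.domainCapacity (f n) (k n) v =
      G.totalLength * k n / Real.pi - G.neumannCount (f n) +
        (Fintype.card E - (G.boundary.ncard : ℝ)) := by linarith
  refine ⟨fun u _ v _ h => MetricGraph.eq_of_reachable_cut hcut h, ?_, ?_, ?_⟩
  · unfold MetricGraph.nodalSurplus MetricGraph.neumannSurplus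
    have h3 : ∑ v ∈ G.interiorVertices, (G.domainPosition (f n) (k n) v : ℤ) =
      (G.nodalCount (f n) : ℤ) - G.neumannCount (f n) +
        (Fintype.card E - (G.boundary.ncard : ℤ)) := by exact_mod_cast h1
    rw [h3]
    ring
  · rw [h2]
    unfold MetricGraph.neumannSurplus
    push_cast
    ring
  · rw [Finset.sum_sub_distrib, h1, h2]
    unfold MetricGraph.nodalSurplus
    push_cast
    ring
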